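/- \textbf{Model.} There are $n$ candidates; candidate $i\in[n]$ has utility $\rho_i\ge 0$ for a receiver $\mathcal R$ and utility $\xi_i\ge 0$ for a sender $\mathcal S$. The $\rho_i$ are pairwise distinct and the $\xi_i$ are pairwise distinct; let $c_{\mathcal S}=\arg\max_i \xi_i$. The candidates arrive in rounds $1,\dots,n$ in uniformly random order. $\mathcal R$ knows all the pairs $(\rho_i,\xi_i)$, but not the order of arrival. In each round $t$ the sender observes the pair $\theta_t=(\rho,\xi)$ of the arriving candidate and sends a signal $\sigma_t\in\{\mathrm{HIRE},\mathrm{NOT}\}$; then $\mathcal R$, who sees only the signals $\sigma_1,\dots,\sigma_t$ (no disclosure), irrevocably hires or rejects the current candidate, and hiring ends the process. $\mathcal S$ commits in advance to a (direct, randomized) strategy, which gives for every $t$ the probability of $\sigma_t=\mathrm{HIRE}$ as a function of $\theta_1,\dots,\theta_t$ and $\sigma_1,\dots,\sigma_{t-1}$. In the \emph{basic} scenario the strategy may be chosen with knowledge of all the pairs $(\rho_i,\xi_i)$; in the \emph{secretary} scenario the same strategy is used for all instances with $n$ candidates. The utility of $\mathcal R$ is $\rho_i$ if candidate $i$ is hired,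 and $0$ if nobody is hired. A strategy is \emph{persuasive} for an instance if in every round $t$ that is reached by an obedient receiver (one who hires exactly upon the signal HIRE) and for all signals $\sigma_1,\dots,\sigma_t$ that she may have received, her conditional expected utility from obedience is at least that from any other way of playing in rounds $t,\dots,n$ based on the signals. The \emph{success probability} of a strategy is the probability that an obedient receiver hires $c_{\mathcal S}$. The \emph{benchmark} $\mathrm{OPT}$ of an instance is the supremum of the success probabilities of all persuasive strategies in the basic scenario. \textbf{Pareto procedure} (ordinal sender utility). The input is a finite nonempty set $A$ of valuation pairs. Scale the receiver values such that their maximum over $A$ is $1$, and replace the sender value of the best candidate $c\in A$ for the sender by $1$ and all other sender values by $0$. Let $\mu$ be the average receiver value in $A$. If $\rho_{c}\ge\mu$, set $a=b=c$; otherwise let $a,b\in A$ be the ends of a segment of the Pareto frontier (the set of non-dominated points) of the convex hull of the points $(\rho_i,\xi_i)$, $i\in A$, that meets the line $\rho=\mu$. Let $\alpha=1$ if $\rho_a=\rho_b$, let $\alpha=0$ if $\rho_a\neq\rho_b$ and $\xi_a=\xi_b$, and $\alpha=\frac{\mu-\rho_b}{\rho_a-\rho_b}$ otherwise. Return $a$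 with probability $\alpha$ and $b$ otherwise. \textbf{Growing Pareto mechanism} with sample size $s$. As long as no HIRE has been signaled: in each round $t\le n-1$ signal NOT if $t\le s$; if $t>s$, apply the Pareto procedure (with fresh randomness) to the set of the $t$ candidates that have arrived so far, and signal HIRE if it returns the candidate of round $t$, and NOT otherwise; in round $n$ signal HIRE. After a HIRE signal, all later signals are NOT. \textbf{Theorem.} For every $n$ and every instance with $n$ candidates, the Growing Pareto mechanism with $s=\lfloor n/2\rfloor$ is persuasive. Moreover, there is a sequence $\varepsilon_n\to 0$ such that for every $n$ and every instance with $n$ candidates its success probability is at least $\left(\frac14-\varepsilon_n\right)\mathrm{OPT}$. -/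

import Mathlib

namespace OnlinePersuasion

/-! ## Instances, signaling strategies and decision rules -/

/-- `n` candidates; candidate `i` has utility `rv i` for the receiver and `sv i` for the sender.
Utilities are non-negative, and no two candidates are equally good for the same player. -/
structure Instance (n : ℕ) where
  rv : Fin n → ℝ
  sv : Fin n → ℝ
  rv_nonneg : ∀ i, 0 ≤ rv i
  sv_nonneg : ∀ i, 0 ≤ sv i
  rv_injective : Function.Injective rv
  sv_injective : Function.Injective sv

/-- The valuation pairs (receiver value, sender value) revealed to the sender in rounds
`0, …, n - 1` when candidate `π t` arrives in round `t`. -/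
def Instance.states {n : ℕ} (I : Instance n) (π : Equiv.Perm (Fin n)) : Fin n → ℝ × ℝ :=
  fun t => (I.rv (π t), I.sv (π t))

/-- A randomized direct signaling strategy for `n` rounds (`true` is HIRE, `false` is NOT).
`hireProb t θ σ` is the probability of signaling HIRE in round `t`, provided that nobody has been
hired before, when `θ` are the valuation pairs revealed in rounds `≤ t` and `σ` are the signals sent
in rounds `< t`; it may not depend on any other entries of `θ` and `σ`. -/
structure Strategy (n : ℕ) where
  hireProb : Fin n → (Fin n → ℝ × ℝ) → (Fin n → Bool) → ℝ
  nonneg : ∀ t θ σ, 0 ≤ hireProb t θ σ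
  le_one : ∀ t θ σ, hireProb t θ σ ≤ 1
  adapted : ∀ t θ θ' σ σ', (∀ i ≤ t, θ i = θ' i) → (∀ i < t, σ i = σ' i) →
    hireProb t θ σ = hireProb t θ' σ'

/-- Probability that, while nobody is hired, the signals are `σ`, given the revealed pairs `θ`. -/
noncomputable def Strategy.signalProb {n : ℕ} (φ : Strategy n) (θ : Fin n → ℝ × ℝ)
    (σ : Fin n → Bool) : ℝ :=
  ∏ t, if σ t then φ.hireProb t θ σ else 1 - φ.hireProb t θ σ

/-- Expectation of `f`, a function of the arrival order and of the signals, over a uniformly random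
arrival order and the internal randomization of the strategy. -/
noncomputable def Strategy.expect {n : ℕ} (φ : Strategy n) (I : Instance n)
    (f : Equiv.Perm (Fin n) → (Fin n → Bool) → ℝ) : ℝ :=
  (∑ π : Equiv.Perm (Fin n), ∑ σ : Fin n → Bool, φ.signalProb (I.states π) σ * f π σ) /
    (n.factorial : ℝ)

/-- A decision rule of the receiver without disclosure: whether to hire in round `t` (if nobody has
been hired before) depends on the signals received in rounds `≤ t` only. -/
structure DecisionRule (n : ℕ) where
  hire : Fin n → (Fin n → Bool) → Prop
  adapted : ∀ t σ σ', (∀ i ≤ t, σ i = σ' i) → (hire t σ ↔ hire t σ')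

/-- The obedient rule: hire exactly upon the signal HIRE. -/
def DecisionRule.obedient (n : ℕ) : DecisionRule n where
  hire t σ := σ t = true
  adapted t σ σ' h := by rw [h t le_rfl]

/-- Using `ψ` from round `t` on, the receiver hires in round `i`. -/
def DecisionRule.HiresAt {n : ℕ} (ψ : DecisionRule n) (t : Fin n) (σ : Fin n → Bool)
    (i : Fin n) : Prop :=
  t ≤ i ∧ ψ.hire i σ ∧ ∀ j, t ≤ j → j < i → ¬ ψ.hire j σ

open Classical in
/-- Receiver's utility when she uses `ψ` from round `t` on (`0` if she never hires). -/
noncomputable def DecisionRule.payoff {n : ℕ} (ψ : DecisionRule n) (I : Instance n) (t : Fin n)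
    (π : Equiv.Perm (Fin n)) (σ : Fin n → Bool) : ℝ :=
  ∑ i, if ψ.HiresAt t σ i then I.rv (π i) else 0

open Classical in
/-- Persuasiveness without disclosure for a receiver with cardinal utility: in every round `t` that
an obedient receiver reaches, and for every possible sequence `h` of the signals received so far
(round `t` included, so only NOT before round `t`), no way of playing from round `t` on has a
strictly larger expected utility than obedience, given these signals. Both conditional expectations
are multiplied by the probability of the signals `h`. -/
def Strategy.Persuasive {n : ℕ} (φ : Strategy n) (I : Instance n) : Prop :=
  ∀ (t : Fin n) (h : Fin n → Bool), (∀ i < t, h i = false) → ∀ ψ : DecisionRule n,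
    φ.expect I (fun π σ => if ∀ i ≤ t, σ i = h i then ψ.payoff I t π σ else 0) ≤
      φ.expect I (fun π σ =>
        if ∀ i ≤ t, σ i = h i then (DecisionRule.obedient n).payoff I t π σ else 0)

open Classical in
/-- The sender's success probability with an obedient receiver: the probability that the candidate
who arrives in the round of the first HIRE signal is the best one for the sender. -/
noncomputable def Strategy.success {n : ℕ} (φ : Strategy n) (I : Instance n) : ℝ :=
  φ.expect I (fun π σ =>
    if ∃ t, (σ t = true ∧ ∀ j < t, σ j = false) ∧ ∀ k, I.sv k ≤ I.sv (π t) then 1 else 0)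

/-- The benchmark, i.e. the basic scenario without disclosure: the best success probability of a
persuasive strategy that may be designed for the given, fully known instance. -/
noncomputable def benchmarkSuccess {n : ℕ} (I : Instance n) : ℝ :=
  sSup {p | ∃ φ : Strategy n, φ.Persuasive I ∧ p = φ.success I}

/-! ## The Pareto procedure -/

section Pareto

variable {ι : Type*}

/-- The Pareto frontier of a set in the plane: its points that are not dominated by another one. -/
def paretoFrontier (C : Set (ℝ × ℝ)) : Set (ℝ × ℝ) :=
  {p | p ∈ C ∧ ∀ q ∈ C, p.1 ≤ q.1 → p.2 ≤ q.2 → q = p}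

/-- The average receiver value of the candidates in `A`. -/
noncomputable def mean (A : Finset ι) (ρ : ι → ℝ) : ℝ := (∑ i ∈ A, ρ i) / (A.card : ℝ)

/-- `(a, b)` is a pair found by the Pareto procedure on the candidates in `A` with receiver values
`ρ` and sender values `ξ`: the sender's favorite `c` twice if its receiver value is at least the
average, and otherwise the ends of a segment of the Pareto frontier of the convex hull that meets
the vertical line through the average receiver value. -/
def IsParetoPair (A : Finset ι) (ρ ξ : ι → ℝ) (a b : ι) : Prop :=
  ∃ c ∈ A, (∀ j ∈ A, ξ j ≤ ξ c) ∧
    ((mean A ρ ≤ ρ c ∧ a = c ∧ b = c) ∨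
     (ρ c < mean A ρ ∧ a ∈ A ∧ b ∈ A ∧
      segment ℝ (ρ a, ξ a) (ρ b, ξ b) ⊆
        paretoFrontier (convexHull ℝ ((fun i => (ρ i, ξ i)) '' (A : Set ι))) ∧
      ∃ p ∈ segment ℝ (ρ a, ξ a) (ρ b, ξ b), p.1 = mean A ρ))

open Classical in
/-- The weight `α` of `a`. -/
noncomputable def paretoWeight (A : Finset ι) (ρ ξ : ι → ℝ) (a b : ι) : ℝ :=
  if ρ a = ρ b then 1
  else if ξ a = ξ b then 0
  else (mean A ρ - ρ b) / (ρ a - ρ b)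

/-- The pair `(a, b)` used by the Pareto procedure. -/
noncomputable def paretoPair [Nonempty ι] (A : Finset ι) (ρ ξ : ι → ℝ) : ι × ι :=
  Classical.epsilon fun ab => IsParetoPair A ρ ξ ab.1 ab.2

/-- A pair as in `IsParetoPair` exists if the sender only values one candidate. -/
theorem exists_isParetoPair (A : Finset ι) (ρ ξ : ι → ℝ) (c : ι) (hc : c ∈ A) (h1 : ξ c = 1)
    (h0 : ∀ j ∈ A, j ≠ c → ξ j = 0) : ∃ a b, IsParetoPair A ρ ξ a b := by
  have hmax : ∀ j ∈ A, ξ j ≤ ξ c := by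
    intro j hj
    by_cases h : j = c
    · rw [h]
    · rw [h0 j hj h, h1]; exact zero_le_one
  rcases le_or_gt (mean A ρ) (ρ c) with hle | hlt
  · exact ⟨c, c, c, hc, hmax, Or.inl ⟨hle, rfl, rfl⟩⟩
  obtain ⟨b, hb, hbmax⟩ := A.exists_max_image ρ ⟨c, hc⟩
  have hpos : (0 : ℝ) < A.card := by exact_mod_cast Finset.card_pos.2 ⟨c, hc⟩
  have hmb : mean A ρ ≤ ρ b := by
    unfold mean
    rw [div_le_iff₀ hpos]
    calc ∑ i ∈ A, ρ i ≤ A.card • ρ b := Finset.sum_le_card_nsmul A ρ _ hbmax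
      _ = ρ b * A.card := by rw [nsmul_eq_mul, mul_comm]
  have hcb : ρ c < ρ b := hlt.trans_le hmb
  have hne : b ≠ c := fun h => by rw [h] at hcb; exact lt_irrefl _ hcb
  have hξb : ξ b = 0 := h0 b hb hne
  refine ⟨c, b, c, hc, hmax, Or.inr ⟨hlt, hc, hb, ?_, ?_⟩⟩
  · have hhull : ∀ q ∈ convexHull ℝ ((fun i => (ρ i, ξ i)) '' (A : Set ι)),
        q.1 + (ρ b - ρ c) * q.2 ≤ ρ b := by
      have hconv : Convex ℝ {q : ℝ × ℝ | q.1 + (ρ b - ρ c) * q.2 ≤ ρ b} := by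
        intro x hx y hy u v hu hv huv
        simp only [Set.mem_ofPred_eq, Prod.fst_add, Prod.snd_add, Prod.smul_fst, Prod.smul_snd,
          smul_eq_mul] at hx hy ⊢
        have e : ρ b = u * ρ b + v * ρ b := by rw [← add_mul, huv, one_mul]
        nlinarith [mul_le_mul_of_nonneg_left hx hu, mul_le_mul_of_nonneg_left hy hv]
      refine fun q hq => convexHull_min ?_ hconv hq
      rintro _ ⟨i, hi, rfl⟩
      simp only [Set.mem_ofPred_eq]
      by_cases h : i = c
      · rw [h, h1]; linarith
      · rw [h0 i hi h]; linarith [hbmax i hi]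
    rintro p ⟨u, v, hu, hv, huv, rfl⟩
    have hmem : ∀ i ∈ A, (ρ i, ξ i) ∈ convexHull ℝ ((fun i => (ρ i, ξ i)) '' (A : Set ι)) :=
      fun i hi => subset_convexHull ℝ _ ⟨i, hi, rfl⟩
    refine ⟨(convex_convexHull ℝ _) (hmem c hc) (hmem b hb) hu hv huv, ?_⟩
    intro q hq h1' h2'
    have hq' := hhull q hq
    simp only [Prod.fst_add, Prod.snd_add, Prod.smul_fst, Prod.smul_snd, smul_eq_mul, h1, hξb]
      at h1' h2'
    obtain rfl : v = 1 - u := by linarith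
    have hd : 0 < ρ b - ρ c := by linarith
    have hq2 : q.2 = u := by
      apply le_antisymm _ (by linarith)
      nlinarith
    ext
    · simp only [Prod.fst_add, Prod.smul_fst, smul_eq_mul]
      rw [hq2] at hq'
      linarith
    · simp [hq2, h1, hξb]
  · have hd : 0 < ρ b - ρ c := by linarith
    refine ⟨_, ⟨(ρ b - mean A ρ) / (ρ b - ρ c), (mean A ρ - ρ c) / (ρ b - ρ c), ?_, ?_, ?_, rfl⟩, ?_⟩
    · exact div_nonneg (by linarith) hd.le
    · exact div_nonneg (by linarith) hd.le
    · field_simp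
      ring
    · simp only [Prod.fst_add, Prod.smul_fst, smul_eq_mul]
      field_simp
      ring

/-- Probability that the number `x`, drawn uniformly from `[0, 1]`, satisfies `x ≤ α` for the weight
`α` of the first candidate of the pair. -/
noncomputable def paretoFirstProb [Nonempty ι] (A : Finset ι) (ρ ξ : ι → ℝ) : ℝ :=
  max 0 (min 1 (paretoWeight A ρ ξ (paretoPair A ρ ξ).1 (paretoPair A ρ ξ).2))

open Classical in
/-- Probability that the Pareto procedure returns `i`: it returns `a` if `x ≤ α` and `b` otherwise. -/
noncomputable def paretoReturnProb [Nonempty ι] (A : Finset ι) (ρ ξ : ι → ℝ) (i : ι) : ℝ :=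
  (if i = (paretoPair A ρ ξ).1 then paretoFirstProb A ρ ξ else 0) +
    (if i = (paretoPair A ρ ξ).2 then 1 - paretoFirstProb A ρ ξ else 0)

theorem paretoReturnProb_mem [Nonempty ι] (A : Finset ι) (ρ ξ : ι → ℝ) (i : ι) :
    0 ≤ paretoReturnProb A ρ ξ i ∧ paretoReturnProb A ρ ξ i ≤ 1 := by
  have h0 : 0 ≤ paretoFirstProb A ρ ξ := le_max_left _ _
  have h1 : paretoFirstProb A ρ ξ ≤ 1 := max_le zero_le_one (min_le_left _ _)
  unfold paretoReturnProb
  split_ifs <;> constructor <;> linarith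

/-- Receiver values scaled such that the maximum over `A` is `1`. -/
noncomputable def scaledValue (A : Finset ι) (ρ : ι → ℝ) (i : ι) : ℝ :=
  ρ i / sSup (ρ '' (A : Set ι))

open Classical in
/-- Sender values for ordinal sender utility: `1` for the sender's best candidate in `A`, else `0`. -/
noncomputable def ordinalValue (A : Finset ι) (ξ : ι → ℝ) (i : ι) : ℝ :=
  if ∀ j ∈ A, ξ j ≤ ξ i then 1 else 0

end Pareto

/-- Probability that the Pareto procedure for ordinal sender utility, applied to the set `A` of
valuation pairs (receiver value, sender value), returns `c`. -/
noncomputable def ordinalParetoProb (A : Finset (ℝ × ℝ)) (c : ℝ × ℝ) : ℝ :=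
  paretoReturnProb A (scaledValue A Prod.fst) (ordinalValue A Prod.snd) c

/-! ## The Growing Pareto mechanism -/

open Classical in
/-- The set of valuation pairs revealed in the rounds up to `t`. -/
noncomputable def arrived {n : ℕ} (θ : Fin n → ℝ × ℝ) (t : Fin n) : Finset (ℝ × ℝ) :=
  (Finset.Iic t).image θ

open Classical in
/-- The Growing Pareto mechanism with sample size `s` for ordinal sender utility. Round `t` is the
`(t + 1)`-st one. It does not depend on the instance except through the revealed pairs. -/
noncomputable def growingPareto (n s : ℕ) : Strategy n where
  hireProb t θ σ :=
    if ∃ i < t, σ i = true then 0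
    else if (t : ℕ) + 1 = n then 1
    else if (t : ℕ) + 1 ≤ s then 0
    else ordinalParetoProb (arrived θ t) (θ t)
  nonneg t θ σ := by
    split_ifs
    exacts [le_rfl, zero_le_one, le_rfl, (paretoReturnProb_mem _ _ _ _).1]
  le_one t θ σ := by
    split_ifs
    exacts [zero_le_one, le_rfl, zero_le_one, (paretoReturnProb_mem _ _ _ _).2]
  adapted t θ θ' σ σ' hθ hσ := by
    have h1 : arrived θ t = arrived θ' t :=
      Finset.image_congr fun i hi => hθ i (by simpa using hi)
    have h2 : (∃ i < t, σ i = true) ↔ ∃ i < t, σ' i = true :=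
      exists_congr fun i => and_congr_right fun hi => by rw [hσ i hi]
    simp only [h1, h2, hθ t le_rfl]

end OnlinePersuasion

/-!
The Pareto procedure returns the sender's favorite `c` with the largest probability `p` for which
a lottery between `c` and the receiver's best candidate is worth at least the average receiver
value (`favoriteProb`), and the receiver's best candidate otherwise.

*Persuasiveness.* Given the set of the first `t` candidates and the order of the later ones, the
newcomer of round `t` is uniformly distributed on this set. Hence a HIRE signal in round `t` is
independent of the later arrivals, and the candidate it is sent for has on average at least the
average value. The candidate of round `i` has on average exactly the average value, and at least
this if HIRE is signaled up to round `i`, so at most this if HIRE is signaled later: hiring without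
a HIRE signal does not pay either.

*Success.* A receiver may hire the first candidate unseen, so no persuasive strategy succeeds with
probability above `p` on the set of all candidates. The Growing Pareto mechanism is still running
in round `t > s` with probability `s / (t - 1)` and then hires `c` if `c` is the newcomer and is
returned. Let `q t` be the expectation of `p` on the set of the first `t` candidates, where `p`
counts as `0` if `c` is not in this set. When a random candidate other than `c` is removed from a
set of size `m`, the expectation of `p` drops at most by the factor `(m - 2) / (m - 1)`, whence
`q t ≥ t (t - 1) / (n (n - 1)) * p`. Summing the contributions `s / (t - 1) * q t / t` of the rounds
`s < t < n` yields `s (n - 1 - s) / (n (n - 1)) * p`, which tends to `p / 4` for `s = n / 2`.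
-/

namespace OnlinePersuasion

open Finset Equiv
open scoped BigOperators

/-! ## The weight of the sender's favorite -/

section FavoriteProb

variable {ι : Type*} {A : Finset ι} {ρ : ι → ℝ} {b c : ι}

theorem mean_eq_expect (A : Finset ι) (ρ : ι → ℝ) : mean A ρ = 𝔼 i ∈ A, ρ i :=
  (expect_eq_sum_div_card ..).symm

theorem mean_le_of_forall_le (hb : b ∈ A) (hmax : ∀ j ∈ A, ρ j ≤ ρ b) : mean A ρ ≤ ρ b := by
  rw [mean_eq_expect]
  exact expect_le ⟨b, hb⟩ hmax

theorem sSup_image_eq_of_forall_le (hb : b ∈ A) (hmax : ∀ j ∈ A, ρ j ≤ ρ b) :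
    sSup (ρ '' (A : Set ι)) = ρ b :=
  IsGreatest.csSup_eq ⟨Set.mem_image_of_mem ρ hb, Set.forall_mem_image.2 hmax⟩

/-- The largest weight `p ≤ 1` of `c` for which a lottery between `c` and the receiver's best
candidate in `A` is on average at least as good for the receiver as a random candidate in `A`
(see `le_favoriteProb_iff`). The Pareto procedure returns the sender's favorite with this
probability. -/
noncomputable def favoriteProb (A : Finset ι) (ρ : ι → ℝ) (c : ι) : ℝ :=
  if mean A ρ ≤ ρ c then 1
  else (sSup (ρ '' (A : Set ι)) - mean A ρ) / (sSup (ρ '' (A : Set ι)) - ρ c)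

theorem favoriteProb_of_mean_le (h : mean A ρ ≤ ρ c) : favoriteProb A ρ c = 1 :=
  if_pos h

theorem favoriteProb_of_lt_mean (hb : b ∈ A) (hmax : ∀ j ∈ A, ρ j ≤ ρ b) (h : ρ c < mean A ρ) :
    favoriteProb A ρ c = (ρ b - mean A ρ) / (ρ b - ρ c) := by
  rw [favoriteProb, if_neg h.not_ge, sSup_image_eq_of_forall_le hb hmax]

theorem le_favoriteProb_iff (hb : b ∈ A) (hmax : ∀ j ∈ A, ρ j ≤ ρ b) (hc : c ∈ A) {x : ℝ} :
    x ≤ favoriteProb A ρ c ↔ x ≤ 1 ∧ mean A ρ ≤ x * ρ c + (1 - x) * ρ b := by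
  have hcb := hmax c hc
  rcases le_or_gt (mean A ρ) (ρ c) with h | h
  · rw [favoriteProb_of_mean_le h, iff_self_and]
    intro hx
    nlinarith
  · have hmb := mean_le_of_forall_le hb hmax
    rw [favoriteProb_of_lt_mean hb hmax h, le_div_iff₀ (by linarith)]
    constructor
    · intro hx
      exact ⟨by nlinarith, by linarith⟩
    · rintro ⟨-, hx⟩
      linarith

theorem favoriteProb_le_one (hc : c ∈ A) : favoriteProb A ρ c ≤ 1 := by
  obtain ⟨b, hb, hmax⟩ := A.exists_max_image ρ ⟨c, hc⟩
  exact ((le_favoriteProb_iff hb hmax hc).1 le_rfl).1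

theorem mean_le_favoriteProb_lottery (hb : b ∈ A) (hmax : ∀ j ∈ A, ρ j ≤ ρ b) (hc : c ∈ A) :
    mean A ρ ≤ favoriteProb A ρ c * ρ c + (1 - favoriteProb A ρ c) * ρ b :=
  ((le_favoriteProb_iff hb hmax hc).1 le_rfl).2

theorem favoriteProb_nonneg (hc : c ∈ A) : 0 ≤ favoriteProb A ρ c := by
  obtain ⟨b, hb, hmax⟩ := A.exists_max_image ρ ⟨c, hc⟩
  refine (le_favoriteProb_iff hb hmax hc).2 ⟨zero_le_one, ?_⟩
  simpa using mean_le_of_forall_le hb hmax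

/-- A uniformly random candidate of `A` is `c` with probability `1 / #A`, and moving the remaining
weight to the receiver's best candidate can only help her. -/
theorem one_div_card_le_favoriteProb (hc : c ∈ A) : 1 / (#A : ℝ) ≤ favoriteProb A ρ c := by
  obtain ⟨b, hb, hmax⟩ := A.exists_max_image ρ ⟨c, hc⟩
  have hA : (1 : ℝ) ≤ #A := by exact_mod_cast card_pos.2 ⟨c, hc⟩
  have hsum : ρ b - ρ c ≤ ∑ i ∈ A, (ρ b - ρ i) :=
    single_le_sum (f := fun i => ρ b - ρ i) (fun i hi => sub_nonneg.2 (hmax i hi)) hc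
  rw [sum_sub_distrib, sum_const, nsmul_eq_mul] at hsum
  refine (le_favoriteProb_iff hb hmax hc).2 ⟨(div_le_one (by linarith)).2 hA, ?_⟩
  rw [mean, div_le_iff₀ (by linarith)]
  field_simp
  linarith

theorem favoriteProb_eq_one_of_forall_le (hmax : ∀ j ∈ A, ρ j ≤ ρ c) (hc : c ∈ A) :
    favoriteProb A ρ c = 1 :=
  favoriteProb_of_mean_le (mean_le_of_forall_le hc hmax)

theorem favoriteProb_eq_min (hb : b ∈ A) (hmax : ∀ j ∈ A, ρ j ≤ ρ b) (hcb : ρ c < ρ b) :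
    favoriteProb A ρ c = min 1 (mean A fun i => (ρ b - ρ i) / (ρ b - ρ c)) := by
  have hd : 0 < ρ b - ρ c := sub_pos.2 hcb
  have hmean : mean A (fun i => (ρ b - ρ i) / (ρ b - ρ c)) = (ρ b - mean A ρ) / (ρ b - ρ c) := by
    simp only [mean_eq_expect, ← expect_div, expect_sub_distrib, expect_const ⟨b, hb⟩]
  rw [hmean]
  rcases le_or_gt (mean A ρ) (ρ c) with h | h
  · rw [favoriteProb_of_mean_le h, min_eq_left ((one_le_div hd).2 (by linarith))]
  · rw [favoriteProb_of_lt_mean hb hmax h, min_eq_right ((div_le_one hd).2 (by linarith))]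

theorem mean_div (A : Finset ι) (ρ : ι → ℝ) (m : ℝ) : mean A (fun i => ρ i / m) = mean A ρ / m := by
  simp only [mean_eq_expect, expect_div]

theorem favoriteProb_scaledValue (hnonneg : ∀ j ∈ A, 0 ≤ ρ j) (hc : c ∈ A) :
    favoriteProb A (scaledValue A ρ) c = favoriteProb A ρ c := by
  obtain ⟨b, hb, hmax⟩ := A.exists_max_image ρ ⟨c, hc⟩
  have hscaled : scaledValue A ρ = fun i => ρ i / ρ b :=
    funext fun i => by rw [scaledValue, sSup_image_eq_of_forall_le hb hmax]
  rw [hscaled]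
  rcases (hnonneg b hb).eq_or_lt with h0 | hpos
  · have hcb : ρ c = ρ b := le_antisymm (hmax c hc) (h0 ▸ hnonneg c hc)
    rw [favoriteProb_eq_one_of_forall_le (fun j _ => by rw [← h0, div_zero, div_zero]) hc,
      favoriteProb_eq_one_of_forall_le (fun j hj => hcb ▸ hmax j hj) hc]
  · refine eq_of_forall_le_iff fun x => ?_
    rw [le_favoriteProb_iff hb hmax hc, le_favoriteProb_iff hb
      (fun j hj => div_le_div_of_nonneg_right (hmax j hj) hpos.le) hc, mean_div,
      ← mul_div_assoc, ← mul_div_assoc, ← add_div, div_le_div_iff_of_pos_right hpos]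

theorem favoriteProb_map {κ : Type*} (e : κ ↪ ι) (A : Finset κ) (ρ : ι → ℝ) (c : κ) :
    favoriteProb (A.map e) ρ (e c) = favoriteProb A (ρ ∘ e) c := by
  rw [favoriteProb, favoriteProb, coe_map, Set.image_comp, mean, mean, sum_map, card_map]
  rfl

end FavoriteProb

section EraseCandidate

variable {ι : Type*} {A : Finset ι}

theorem sum_max_zero_sub_le {y : ι → ℝ} {u : ℝ} (hu : 0 ≤ u) (hy : ∀ i ∈ A, 0 ≤ y i) :
    ∑ i ∈ A, max 0 (y i - u) ≤ max 0 (∑ i ∈ A, y i - u) := by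
  classical
  induction A using Finset.induction_on with
  | empty => simp
  | insert a A ha ih =>
    rw [forall_mem_insert] at hy
    rw [sum_insert ha, sum_insert ha]
    have hsum := sum_nonneg hy.2
    specialize ih hy.2
    grind

theorem card_sub_one_le_sum_min {y : ι → ℝ} (hy : ∀ i ∈ A, 0 ≤ y i) (hA : #A ≤ ∑ i ∈ A, y i) :
    #A - 1 ≤ ∑ i ∈ A, min 1 ((∑ j ∈ A, y j + 1 - y i) / (#A + 1)) := by
  set S := ∑ j ∈ A, y j
  have hpos : (0 : ℝ) < #A + 1 := by positivity
  have hloss (i : ι) : 1 - min 1 ((S + 1 - y i) / (#A + 1)) =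
      max 0 (y i - (S - #A)) / (#A + 1) := by
    rw [← max_div_div_right hpos.le, zero_div, ← max_sub_sub_left, sub_self]
    congr 1
    field_simp
    ring
  have htotal := sum_max_zero_sub_le (sub_nonneg.2 hA) hy
  rw [sub_sub_cancel, max_eq_right (Nat.cast_nonneg _)] at htotal
  have hle : ∑ i ∈ A, (1 - min 1 ((S + 1 - y i) / (#A + 1))) ≤ 1 := by
    simp only [hloss, ← sum_div]
    rw [div_le_one hpos]
    linarith
  rw [sum_sub_distrib, sum_const, nsmul_one] at hle
  linarith

theorem card_mul_min_le_sum_min_add {y : ι → ℝ} (hy : ∀ i ∈ A, 0 ≤ y i)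
    (hA : ∑ i ∈ A, y i ≤ #A) :
    #A * min 1 ((∑ i ∈ A, y i + 1) / (#A + 2)) ≤
      ∑ i ∈ A, min 1 ((∑ j ∈ A, y j + 1 - y i) / (#A + 1)) + 1 / (#A + 1) := by
  set S := ∑ j ∈ A, y j
  have hpos : (0 : ℝ) < #A + 1 := by positivity
  have hmin : ∀ i ∈ A, min 1 ((S + 1 - y i) / (#A + 1)) = (S + 1 - y i) / (#A + 1) := fun i hi =>
    min_eq_right ((div_le_one hpos).2 (by linarith [hy i hi]))
  calc #A * min 1 ((S + 1) / (#A + 2)) ≤ #A * ((S + 1) / (#A + 2)) :=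
      mul_le_mul_of_nonneg_left (min_le_right _ _) (Nat.cast_nonneg _)
    _ ≤ (#A * (S + 1) - S + 1) / (#A + 1) := by
      rw [← mul_div_assoc, div_le_div_iff₀ (by positivity) hpos]
      linarith
    _ = ∑ i ∈ A, min 1 ((S + 1 - y i) / (#A + 1)) + 1 / (#A + 1) := by
      rw [sum_congr rfl hmin, ← sum_div, sum_sub_distrib, sum_const, nsmul_eq_mul, ← add_div]

theorem favoriteProb_erase_eq_min [DecidableEq ι] {ρ : ι → ℝ} {b c x : ι} (hb : b ∈ A.erase x)
    (hmax : ∀ j ∈ A, ρ j ≤ ρ b) (hcb : ρ c < ρ b) (hx : x ∈ A) :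
    favoriteProb (A.erase x) ρ c = min 1 ((∑ i ∈ A, (ρ b - ρ i) / (ρ b - ρ c) -
      (ρ b - ρ x) / (ρ b - ρ c)) / (#A - 1)) := by
  rw [favoriteProb_eq_min hb (fun j hj => hmax j (mem_of_mem_erase hj)) hcb, mean,
    sum_erase_eq_sub hx, cast_card_erase_of_mem hx]

theorem mean_erase_le [DecidableEq ι] {ρ : ι → ℝ} {b c : ι} (hb : b ∈ A) (hcb : ρ c < ρ b)
    (hA : (1 : ℝ) < #A) (h : #A - 1 ≤ ∑ i ∈ A, (ρ b - ρ i) / (ρ b - ρ c)) :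
    mean (A.erase b) ρ ≤ ρ c := by
  rw [← sum_div, le_div_iff₀ (sub_pos.2 hcb), sum_sub_distrib, sum_const, nsmul_eq_mul] at h
  rw [mean, sum_erase_eq_sub hb, cast_card_erase_of_mem hb, div_le_iff₀ (sub_pos.2 hA)]
  linarith

theorem card_sub_two_mul_favoriteProb_le_sum_erase_of_lt [DecidableEq ι] {ρ : ι → ℝ} {b c : ι}
    (hb : b ∈ A) (hmax : ∀ j ∈ A, ρ j ≤ ρ b) (hc : c ∈ A) (hcb : ρ c < ρ b) :
    (#A - 2) * favoriteProb A ρ c ≤ ∑ x ∈ A.erase c, favoriteProb (A.erase x) ρ c := by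
  have hbc : b ∈ A.erase c := mem_erase.2 ⟨fun h => hcb.ne (h ▸ rfl), hb⟩
  set T := (A.erase c).erase b
  set y : ι → ℝ := fun i => (ρ b - ρ i) / (ρ b - ρ c)
  have hy : ∀ i ∈ T, 0 ≤ y i := fun i hi => div_nonneg
    (sub_nonneg.2 (hmax i (mem_of_mem_erase (mem_of_mem_erase hi)))) (sub_nonneg.2 hcb.le)
  have hyA : ∑ i ∈ A, y i = ∑ i ∈ T, y i + 1 := by
    have hyb : y b = 0 := by simp only [y, sub_self, zero_div]
    have hyc : y c = 1 := div_self (sub_ne_zero.2 hcb.ne')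
    rw [← sum_erase_add _ _ hc, ← sum_erase_add _ _ hbc, hyb, hyc, add_zero]
  have hcard : (#A : ℝ) = #T + 2 := by
    rw [cast_card_erase_of_mem hbc, cast_card_erase_of_mem hc]
    ring
  have hcard_sub_one : (#A : ℝ) - 1 = #T + 1 := by linarith
  have hT : ∀ x ∈ T, favoriteProb (A.erase x) ρ c =
      min 1 ((∑ i ∈ T, y i + 1 - y x) / (#T + 1)) := fun x hx => by
    obtain ⟨hxb, hxA⟩ := mem_erase.1 hx
    rw [favoriteProb_erase_eq_min (mem_erase.2 ⟨hxb.symm, hb⟩) hmax hcb (mem_of_mem_erase hxA),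
      hyA, hcard_sub_one]
  rw [← sum_erase_add _ _ hbc, sum_congr rfl hT, hcard, add_sub_cancel_right]
  rcases le_total (∑ i ∈ T, y i) #T with hle | hle
  · have hfav_b : 1 / (#T + 1) ≤ favoriteProb (A.erase b) ρ c := by
      rw [← hcard_sub_one, ← cast_card_erase_of_mem hb]
      exact one_div_card_le_favoriteProb (mem_erase.2 ⟨(ne_of_mem_erase hbc).symm, hc⟩)
    rw [favoriteProb_eq_min hb hmax hcb, mean, hyA, hcard]
    exact (card_mul_min_le_sum_min_add hy hle).trans (by gcongr)
  · have hfav_b : favoriteProb (A.erase b) ρ c = 1 :=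
      favoriteProb_of_mean_le (mean_erase_le hb hcb (by linarith) (by linarith))
    have hsum := card_sub_one_le_sum_min hy hle
    have hle_card := mul_le_of_le_one_right (Nat.cast_nonneg (α := ℝ) #T)
      (favoriteProb_le_one (ρ := ρ) hc)
    linarith

theorem card_sub_two_mul_favoriteProb_le_sum_erase [DecidableEq ι] {ρ : ι → ℝ} {c : ι}
    (hc : c ∈ A) :
    (#A - 2) * favoriteProb A ρ c ≤ ∑ x ∈ A.erase c, favoriteProb (A.erase x) ρ c := by
  obtain ⟨b, hb, hmax⟩ := A.exists_max_image ρ ⟨c, hc⟩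
  rcases (hmax c hc).lt_or_eq with hcb | hcb
  · exact card_sub_two_mul_favoriteProb_le_sum_erase_of_lt hb hmax hc hcb
  · have hfav : ∀ x ∈ A.erase c, favoriteProb (A.erase x) ρ c = 1 := fun x hx =>
      favoriteProb_eq_one_of_forall_le (fun j hj => hcb ▸ hmax j (mem_of_mem_erase hj))
        (mem_erase.2 ⟨(ne_of_mem_erase hx).symm, hc⟩)
    rw [sum_congr rfl hfav, favoriteProb_eq_one_of_forall_le (hcb ▸ hmax) hc, sum_const, nsmul_one,
      cast_card_erase_of_mem hc]
    linarith

end EraseCandidate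

/-! ## The Pareto procedure for ordinal sender utility -/

section ParetoProcedure

variable {ι : Type*} {A : Finset ι} {ρ ξ : ι → ℝ} {b c : ι}

theorem forall_le_of_forall_ne_lt {f : ι → ℝ} (hmax : ∀ j ∈ A, j ≠ b → f j < f b) :
    ∀ j ∈ A, f j ≤ f b := fun j hj =>
  (eq_or_ne j b).elim (fun h => h ▸ le_rfl) fun h => (hmax j hj h).le

theorem eq_or_eq_of_mem_paretoFrontier {x : ι} (h0 : ∀ j ∈ A, j ≠ c → ξ j = 0)
    (hb : b ∈ A) (hmax : ∀ j ∈ A, j ≠ b → ρ j < ρ b) (hbc : b ≠ c) (hx : x ∈ A)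
    (hfront : (ρ x, ξ x) ∈
      paretoFrontier (convexHull ℝ ((fun i => (ρ i, ξ i)) '' (A : Set ι)))) :
    x = c ∨ x = b := by
  by_contra! hne
  have hlt := hmax x hx hne.2
  have hle : ξ x ≤ ξ b := by rw [h0 x hx hne.1, h0 b hb hbc]
  have heq := hfront.2 (ρ b, ξ b) (subset_convexHull ℝ _ ⟨b, hb, rfl⟩) hlt.le hle
  exact hlt.ne' (congrArg Prod.fst heq)

theorem IsParetoPair.eq_of_indicator {x y : ι} (hp : IsParetoPair A ρ ξ x y) (hc : c ∈ A)
    (h1 : ξ c = 1) (h0 : ∀ j ∈ A, j ≠ c → ξ j = 0) (hb : b ∈ A)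
    (hmax : ∀ j ∈ A, j ≠ b → ρ j < ρ b) :
    (mean A ρ ≤ ρ c ∧ x = c ∧ y = c) ∨
      (ρ c < mean A ρ ∧ ((x = c ∧ y = b) ∨ (x = b ∧ y = c))) := by
  obtain ⟨c', hc', hc'max, h⟩ := hp
  obtain rfl : c' = c := by
    by_contra hne
    have hle := hc'max c hc
    rw [h1, h0 c' hc' hne] at hle
    exact zero_lt_one.not_ge hle
  rcases h with h | ⟨hlt, hx, hy, hseg, p, hp, hpmean⟩
  · exact Or.inl h
  refine Or.inr ⟨hlt, ?_⟩
  have hle := forall_le_of_forall_ne_lt hmax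
  have hcb : ρ c' < ρ b := hlt.trans_le (mean_le_of_forall_le hb hle)
  have hmean_lt : mean A ρ < ρ b := by
    rw [mean_eq_expect]
    exact expect_lt hle ⟨c', hc, hcb⟩
  have hbc : b ≠ c' := fun h => hcb.ne' (congrArg ρ h)
  have hxy : ρ x = ρ y → ξ x = ξ y → ρ x = mean A ρ := fun hρ hξ => by
    rw [hρ, hξ, segment_same, Set.mem_singleton_iff] at hp
    rw [hρ, ← hpmean, hp]
  rcases eq_or_eq_of_mem_paretoFrontier h0 hb hmax hbc hx (hseg (left_mem_segment ℝ _ _))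
    with rfl | rfl <;>
  rcases eq_or_eq_of_mem_paretoFrontier h0 hb hmax hbc hy (hseg (right_mem_segment ℝ _ _))
    with rfl | rfl
  · exact absurd (hxy rfl rfl) hlt.ne
  · exact Or.inl ⟨rfl, rfl⟩
  · exact Or.inr ⟨rfl, rfl⟩
  · exact absurd (hxy rfl rfl) hmean_lt.ne'

theorem paretoWeight_favorite_left (h1 : ξ c = 1) (hb : b ∈ A) (hb0 : ξ b = 0)
    (hmax : ∀ j ∈ A, ρ j ≤ ρ b) (hlt : ρ c < mean A ρ) :
    paretoWeight A ρ ξ c b = favoriteProb A ρ c := by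
  have hcb : ρ c < ρ b := hlt.trans_le (mean_le_of_forall_le hb hmax)
  rw [paretoWeight, if_neg hcb.ne, h1, hb0, if_neg one_ne_zero,
    favoriteProb_of_lt_mean hb hmax hlt, ← neg_div_neg_eq, neg_sub, neg_sub]

theorem paretoWeight_favorite_right (h1 : ξ c = 1) (hb : b ∈ A) (hb0 : ξ b = 0)
    (hmax : ∀ j ∈ A, ρ j ≤ ρ b) (hlt : ρ c < mean A ρ) :
    paretoWeight A ρ ξ b c = 1 - favoriteProb A ρ c := by
  have hcb : ρ c < ρ b := hlt.trans_le (mean_le_of_forall_le hb hmax)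
  rw [paretoWeight, if_neg hcb.ne', h1, hb0, if_neg zero_ne_one,
    favoriteProb_of_lt_mean hb hmax hlt, one_sub_div (sub_ne_zero.2 hcb.ne'),
    sub_sub_sub_cancel_left]

theorem paretoReturnProb_of_indicator [Nonempty ι] [DecidableEq ι] (hc : c ∈ A) (h1 : ξ c = 1)
    (h0 : ∀ j ∈ A, j ≠ c → ξ j = 0) (hb : b ∈ A) (hmax : ∀ j ∈ A, j ≠ b → ρ j < ρ b) (i : ι) :
    paretoReturnProb A ρ ξ i = (if i = c then favoriteProb A ρ c else 0) +
      (if i = b then 1 - favoriteProb A ρ c else 0) := by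
  obtain ⟨x, y, hexists⟩ := exists_isParetoPair A ρ ξ c hc h1 h0
  have hpair : IsParetoPair A ρ ξ (paretoPair A ρ ξ).1 (paretoPair A ρ ξ).2 :=
    Classical.epsilon_spec (p := fun ab : ι × ι => IsParetoPair A ρ ξ ab.1 ab.2) ⟨(x, y), hexists⟩
  have hle := forall_le_of_forall_ne_lt hmax
  have hnonneg := favoriteProb_nonneg (ρ := ρ) hc
  have hle_one := favoriteProb_le_one (ρ := ρ) hc
  rw [paretoReturnProb, paretoFirstProb]
  rcases hpair.eq_of_indicator hc h1 h0 hb hmax with ⟨hmean, hx, hy⟩ | ⟨hlt, h⟩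
  · rw [hx, hy, favoriteProb_of_mean_le hmean]
    split_ifs <;> simp
  have hb0 : ξ b = 0 := h0 b hb fun h =>
    (hlt.trans_le (mean_le_of_forall_le hb hle)).ne' (congrArg ρ h)
  rcases h with ⟨hx, hy⟩ | ⟨hx, hy⟩
  · rw [hx, hy, paretoWeight_favorite_left h1 hb hb0 hle hlt, min_eq_right hle_one,
      max_eq_right hnonneg]
    congr
  · rw [hx, hy, paretoWeight_favorite_right h1 hb hb0 hle hlt,
      min_eq_right (by linarith), max_eq_right (by linarith), sub_sub_cancel, add_comm]
    congr

theorem ordinalParetoProb_eq {A : Finset (ℝ × ℝ)} {c b : ℝ × ℝ} (hnonneg : ∀ p ∈ A, 0 ≤ p.1)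
    (hc : c ∈ A) (hcmax : ∀ p ∈ A, p ≠ c → p.2 < c.2) (hb : b ∈ A)
    (hbmax : ∀ p ∈ A, p ≠ b → p.1 < b.1) (x : ℝ × ℝ) :
    ordinalParetoProb A x = (if x = c then favoriteProb A Prod.fst c else 0) +
      (if x = b then 1 - favoriteProb A Prod.fst c else 0) := by
  have h1 : ordinalValue A Prod.snd c = 1 :=
    if_pos (forall_le_of_forall_ne_lt (f := Prod.snd) hcmax)
  have h0 : ∀ p ∈ A, p ≠ c → ordinalValue A Prod.snd p = 0 := fun p hp hne =>
    if_neg fun h => (h c hc).not_gt (hcmax p hp hne)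
  have hscaled : ∀ p ∈ A, p ≠ b → scaledValue A Prod.fst p < scaledValue A Prod.fst b := by
    intro p hp hne
    rw [scaledValue, scaledValue,
      sSup_image_eq_of_forall_le hb (forall_le_of_forall_ne_lt (f := Prod.fst) hbmax)]
    exact div_lt_div_of_pos_right (hbmax p hp hne) ((hnonneg p hp).trans_lt (hbmax p hp hne))
  rw [ordinalParetoProb, paretoReturnProb_of_indicator hc h1 h0 hb hscaled,
    favoriteProb_scaledValue hnonneg hc]

end ParetoProcedure

namespace Instance

variable {n : ℕ} (I : Instance n) {B : Finset (Fin n)} {b c : Fin n}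

/-- The valuation pair of a candidate. -/
def pair (i : Fin n) : ℝ × ℝ := (I.rv i, I.sv i)

theorem pair_injective : Function.Injective I.pair := fun _ _ h =>
  I.rv_injective (congrArg Prod.fst h)

/-- Probability that the Pareto procedure on the candidates in `B` returns `i`. -/
noncomputable def returnProb (B : Finset (Fin n)) (i : Fin n) : ℝ :=
  ordinalParetoProb (B.map ⟨I.pair, I.pair_injective⟩) (I.pair i)

theorem returnProb_eq (hc : c ∈ B) (hcmax : ∀ j ∈ B, I.sv j ≤ I.sv c) (hb : b ∈ B)
    (hbmax : ∀ j ∈ B, I.rv j ≤ I.rv b) (i : Fin n) :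
    I.returnProb B i = (if i = c then favoriteProb B I.rv c else 0) +
      (if i = b then 1 - favoriteProb B I.rv c else 0) := by
  let e : Fin n ↪ ℝ × ℝ := ⟨I.pair, I.pair_injective⟩
  have hfav : favoriteProb (B.map e) Prod.fst (e c) = favoriteProb B I.rv c :=
    favoriteProb_map e B Prod.fst c
  have hcmax' : ∀ p ∈ B.map e, p ≠ e c → p.2 < (e c).2 :=
    forall_mem_map.2 fun j hj hne =>
      (hcmax j hj).lt_of_ne fun h => hne (congrArg _ (I.sv_injective h))
  have hbmax' : ∀ p ∈ B.map e, p ≠ e b → p.1 < (e b).1 :=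
    forall_mem_map.2 fun j hj hne =>
      (hbmax j hj).lt_of_ne fun h => hne (congrArg _ (I.rv_injective h))
  change ordinalParetoProb (B.map e) (e i) = _
  rw [ordinalParetoProb_eq (forall_mem_map.2 fun j _ => I.rv_nonneg j)
    (mem_map_of_mem e hc) hcmax' (mem_map_of_mem e hb) hbmax']
  simp only [hfav, e.apply_eq_iff_eq]

theorem sum_returnProb_mul (hc : c ∈ B) (hcmax : ∀ j ∈ B, I.sv j ≤ I.sv c) (hb : b ∈ B)
    (hbmax : ∀ j ∈ B, I.rv j ≤ I.rv b) (f : Fin n → ℝ) :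
    ∑ i ∈ B, I.returnProb B i * f i =
      favoriteProb B I.rv c * f c + (1 - favoriteProb B I.rv c) * f b := by
  simp only [I.returnProb_eq hc hcmax hb hbmax, add_mul, ite_mul, zero_mul, sum_add_distrib,
    sum_ite_eq', hc, hb, if_true]

theorem sum_returnProb (hB : B.Nonempty) : ∑ i ∈ B, I.returnProb B i = 1 := by
  obtain ⟨c, hc, hcmax⟩ := B.exists_max_image I.sv hB
  obtain ⟨b, hb, hbmax⟩ := B.exists_max_image I.rv hB
  simpa using I.sum_returnProb_mul hc hcmax hb hbmax 1

theorem mean_le_sum_returnProb_mul (hB : B.Nonempty) :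
    mean B I.rv ≤ ∑ i ∈ B, I.returnProb B i * I.rv i := by
  obtain ⟨c, hc, hcmax⟩ := B.exists_max_image I.sv hB
  obtain ⟨b, hb, hbmax⟩ := B.exists_max_image I.rv hB
  rw [I.sum_returnProb_mul hc hcmax hb hbmax]
  exact mean_le_favoriteProb_lottery hb hbmax hc

theorem favoriteProb_le_returnProb (hc : c ∈ B) (hcmax : ∀ j ∈ B, I.sv j ≤ I.sv c) :
    favoriteProb B I.rv c ≤ I.returnProb B c := by
  obtain ⟨b, hb, hbmax⟩ := B.exists_max_image I.rv ⟨c, hc⟩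
  rw [I.returnProb_eq hc hcmax hb hbmax, if_pos rfl, le_add_iff_nonneg_right]
  split_ifs
  exacts [sub_nonneg.2 (favoriteProb_le_one hc), le_rfl]

end Instance

/-! ## Random arrival order -/

section RandomOrder

variable {n : ℕ} {α β : Type*}

/-- The first `t` candidates in the arrival order `π`. -/
def front (π : Perm (Fin n)) (t : ℕ) : Finset (Fin n) :=
  {x | (π.symm x : ℕ) < t}

theorem mem_front {π : Perm (Fin n)} {t : ℕ} {x : Fin n} :
    x ∈ front π t ↔ (π.symm x : ℕ) < t := by
  rw [front, mem_filter_univ]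

theorem front_succ_eq_map (π : Perm (Fin n)) (j : Fin n) :
    front π (j + 1) = (Iic j).map π.toEmbedding := by
  ext x
  rw [mem_map_equiv, mem_front, mem_Iic, Fin.le_def, Nat.lt_succ_iff]

theorem apply_mem_front_succ (π : Perm (Fin n)) (j : Fin n) : π j ∈ front π (j + 1) := by
  rw [mem_front, symm_apply_apply]
  exact Nat.lt_succ_self j

theorem card_front_succ (π : Perm (Fin n)) (j : Fin n) : #(front π (j + 1)) = j + 1 := by
  rw [front_succ_eq_map, card_map, Fin.card_Iic]

theorem front_eq_univ (π : Perm (Fin n)) : front π n = univ :=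
  filter_true_of_mem fun x _ => (π.symm x).2

theorem front_succ_erase (π : Perm (Fin n)) (j : Fin n) :
    (front π (j + 1)).erase (π j) = front π j := by
  ext x
  rw [mem_erase, mem_front, mem_front, Nat.lt_succ_iff, Nat.lt_iff_le_and_ne, and_comm, Ne,
    ← symm_apply_eq, Fin.ext_iff]

/-- `g` does not depend on the order in which the first `t` candidates arrive. -/
def OrderInvariant (t : ℕ) (g : Perm (Fin n) → α) : Prop :=
  ∀ π τ : Perm (Fin n), (∀ j : Fin n, t ≤ j → τ j = j) → g (π * τ) = g π

theorem OrderInvariant.mono {t u : ℕ} {g : Perm (Fin n) → α} (hg : OrderInvariant u g)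
    (htu : t ≤ u) : OrderInvariant t g :=
  fun π τ hτ => hg π τ fun j hj => hτ j (htu.trans hj)

theorem OrderInvariant.comp {t : ℕ} {g : Perm (Fin n) → α} (hg : OrderInvariant t g) (f : α → β) :
    OrderInvariant t fun π => f (g π) :=
  fun π τ hτ => congrArg f (hg π τ hτ)

theorem OrderInvariant.prodMk {t : ℕ} {g : Perm (Fin n) → α} {h : Perm (Fin n) → β}
    (hg : OrderInvariant t g) (hh : OrderInvariant t h) :
    OrderInvariant t fun π => (g π, h π) :=
  fun π τ hτ => Prod.ext (hg π τ hτ) (hh π τ hτ)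

theorem OrderInvariant.mul {t : ℕ} {g h : Perm (Fin n) → ℝ} (hg : OrderInvariant t g)
    (hh : OrderInvariant t h) : OrderInvariant t fun π => g π * h π :=
  (hg.prodMk hh).comp fun p => p.1 * p.2

theorem orderInvariant_const (t : ℕ) (a : α) : OrderInvariant t fun _ : Perm (Fin n) => a :=
  fun _ _ _ => rfl

theorem orderInvariant_apply {t : ℕ} {j : Fin n} (h : t ≤ j) :
    OrderInvariant t fun π : Perm (Fin n) => π j :=
  fun π _ hτ => congrArg π (hτ j h)

theorem orderInvariant_front {t u : ℕ} (htu : t ≤ u) :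
    OrderInvariant t fun π : Perm (Fin n) => front π u := by
  intro π τ hτ
  have hfix : ∀ j : Fin n, u ≤ j → τ j = j := fun j hj => hτ j (htu.trans hj)
  have hlt : ∀ j : Fin n, (τ j : ℕ) < u ↔ (j : ℕ) < u := by
    intro j
    rw [← not_le, ← not_le, not_iff_not]
    refine ⟨fun h => ?_, fun h => (hfix j h).symm ▸ h⟩
    rwa [← τ.injective (hfix (τ j) h)]
  ext x
  have hsymm : τ ((π * τ).symm x) = π.symm x := τ.apply_symm_apply _
  rw [mem_front, mem_front, ← hlt, hsymm]

theorem expect_perm_mul_right (τ : Perm (Fin n)) (g : Perm (Fin n) → ℝ) :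
    𝔼 π, g (π * τ) = 𝔼 π, g π :=
  Fintype.expect_equiv (Equiv.mulRight τ) _ _ fun _ => rfl

theorem expect_apply_eq_expect_front (j : Fin n) {K : Perm (Fin n) → Fin n → ℝ}
    (hK : OrderInvariant (j + 1) K) :
    𝔼 π, K π (π j) = 𝔼 π, 𝔼 x ∈ front π (j + 1), K π x := by
  have hswap : ∀ i ∈ Iic j, 𝔼 π, K π (π i) = 𝔼 π, K π (π j) := by
    intro i hi
    have hij : i ≤ j := mem_Iic.1 hi
    rw [← expect_perm_mul_right (swap i j)]
    refine expect_congr rfl fun π _ => ?_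
    rw [hK π _ fun k hk => swap_apply_of_ne_of_ne (by omega) (by omega), Perm.mul_apply,
      swap_apply_left]
  have hmap : ∀ π ∈ univ, 𝔼 x ∈ front π (j + 1), K π x = 𝔼 i ∈ Iic j, K π (π i) := fun π _ => by
    rw [front_succ_eq_map, map_eq_image, expect_image π.toEmbedding.injective.injOn]
    rfl
  rw [expect_congr rfl hmap, expect_comm, expect_congr rfl hswap, expect_const nonempty_Iic]

theorem expect_apply_eq_mean (ρ : Fin n → ℝ) (j : Fin n) : 𝔼 π : Perm (Fin n), ρ (π j) =
    mean univ ρ := by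
  have hswap : ∀ i ∈ univ, 𝔼 π : Perm (Fin n), ρ (π i) = 𝔼 π : Perm (Fin n), ρ (π j) := by
    intro i _
    rw [← expect_perm_mul_right (swap i j)]
    simp only [Perm.mul_apply, swap_apply_left]
  have hperm : ∀ π ∈ (univ : Finset (Perm (Fin n))), 𝔼 i, ρ (π i) = 𝔼 i, ρ i := fun π _ =>
    Fintype.expect_equiv π _ _ fun _ => rfl
  rw [mean_eq_expect, ← expect_const (s := (univ : Finset (Perm (Fin n)))) univ_nonempty (𝔼 i, ρ i),
    ← expect_congr rfl hperm, expect_comm, expect_congr rfl hswap, expect_const ⟨j, mem_univ j⟩]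

theorem filter_val_lt_succ (j : Fin n) :
    ({u | u.val < j + 1} : Finset (Fin n)) = insert j ({u | u.val < j} : Finset (Fin n)) := by
  ext u
  simp only [mem_filter_univ, mem_insert, Fin.ext_iff]
  omega

/-- The rounds are averaged out one at a time, starting from the last one. -/
theorem expect_prod_mul_of_orderInvariant {F : Fin n → Perm (Fin n) → ℝ} {q : ℕ → ℝ}
    (hF : ∀ u : Fin n, OrderInvariant u (F u))
    (hq : ∀ (u : Fin n) (g : Perm (Fin n) → ℝ), OrderInvariant (u + 1) g →
      𝔼 π, F u π * g π = q u * 𝔼 π, g π)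
    {t : ℕ} (ht : t ≤ n) {g : Perm (Fin n) → ℝ} (hg : OrderInvariant t g) :
    𝔼 π, (∏ u : Fin n with u.val < t, F u π) * g π = (∏ u ∈ range t, q u) * 𝔼 π, g π := by
  induction t generalizing g with
  | zero => simp
  | succ t ih =>
    have hsucc : ∀ π, ∏ u : Fin n with u.val < t + 1, F u π =
        (∏ u : Fin n with u.val < t, F u π) * F ⟨t, ht⟩ π := fun π => by
      rw [filter_val_lt_succ ⟨t, ht⟩, prod_insert (by simp), mul_comm]
    simp only [hsucc, mul_assoc]
    rw [ih (by omega) ((hF ⟨t, ht⟩).mul (hg.mono t.le_succ)), hq ⟨t, ht⟩ g hg, prod_range_succ,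
      mul_assoc]

end RandomOrder

section RandomSubset

variable {n : ℕ} {ρ : Fin n → ℝ} {c : Fin n}

/-- Probability that a procedure that is applied to the first `t` candidates of a random arrival
order, and picks `c` with probability `favoriteProb` if `c` is among them, picks `c`. -/
noncomputable def frontProb (ρ : Fin n → ℝ) (c : Fin n) (t : ℕ) : ℝ :=
  𝔼 π : Perm (Fin n), if c ∈ front π t then favoriteProb (front π t) ρ c else 0

theorem frontProb_zero : frontProb ρ c 0 = 0 := by
  simp [frontProb, front]

theorem frontProb_top : frontProb ρ c n = favoriteProb univ ρ c := by
  simp only [frontProb, front_eq_univ, mem_univ, if_true]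
  exact expect_const univ_nonempty _

theorem frontProb_eq_expect_erase (j : Fin n) : frontProb ρ c j =
    𝔼 π : Perm (Fin n), 𝔼 x ∈ front π (j + 1),
      if c ∈ (front π (j + 1)).erase x then
        favoriteProb ((front π (j + 1)).erase x) ρ c
      else 0 := by
  rw [← expect_apply_eq_expect_front j
    (K := fun π x => if c ∈ (front π (j + 1)).erase x then
      favoriteProb ((front π (j + 1)).erase x) ρ c else 0)
    ((orderInvariant_front le_rfl).comp fun B x =>
      if c ∈ B.erase x then favoriteProb (B.erase x) ρ c else 0)]
  simp only [front_succ_erase, frontProb]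

theorem sub_one_mul_frontProb_succ_le (j : Fin n) :
    (j - 1 : ℝ) * frontProb ρ c (j + 1) ≤ (j + 1) * frontProb ρ c j := by
  rw [frontProb_eq_expect_erase, frontProb, mul_expect, mul_expect]
  refine expect_le_expect fun π _ => ?_
  have hcard : (#(front π (j + 1)) : ℝ) = j + 1 := by exact_mod_cast card_front_succ π j
  rw [← hcard, card_mul_expect]
  split_ifs with hc
  · have herase : (j - 1 : ℝ) = #(front π (j + 1)) - 2 := by linarith
    rw [herase, ← sum_erase_add _ _ hc, if_neg (notMem_erase c _), add_zero]
    refine (card_sub_two_mul_favoriteProb_le_sum_erase hc).trans_eq (sum_congr rfl fun x hx => ?_)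
    rw [if_pos (mem_erase.2 ⟨(ne_of_mem_erase hx).symm, hc⟩)]
  · rw [mul_zero]
    exact sum_nonneg fun x _ => by
      split_ifs with hcx
      exacts [absurd (mem_of_mem_erase hcx) hc, le_rfl]

theorem mul_favoriteProb_univ_le {t : ℕ} (ht : t ≤ n) :
    t * (t - 1 : ℝ) * favoriteProb univ ρ c ≤ n * (n - 1) * frontProb ρ c t := by
  induction ht using Nat.decreasingInduction with
  | self => rw [frontProb_top]
  | @of_succ t ht ih =>
    rcases t.eq_zero_or_pos with rfl | hpos
    · simp [frontProb_zero]
    have hpos' : (1 : ℝ) ≤ t := by exact_mod_cast hpos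
    have hn : (1 : ℝ) ≤ n := by exact_mod_cast (Nat.zero_lt_of_lt ht)
    have hstep : (t - 1 : ℝ) * frontProb ρ c (t + 1) ≤ (t + 1) * frontProb ρ c t :=
      sub_one_mul_frontProb_succ_le ⟨t, ht⟩
    push_cast at ih
    refine le_of_mul_le_mul_left ?_ (by positivity : (0 : ℝ) < t + 1)
    calc (t + 1 : ℝ) * (t * (t - 1) * favoriteProb univ ρ c)
        = (t - 1) * ((t + 1) * (t + 1 - 1) * favoriteProb univ ρ c) := by ring
      _ ≤ (t - 1) * (n * (n - 1) * frontProb ρ c (t + 1)) :=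
        mul_le_mul_of_nonneg_left ih (by linarith)
      _ = n * (n - 1) * ((t - 1) * frontProb ρ c (t + 1)) := by ring
      _ ≤ n * (n - 1) * ((t + 1) * frontProb ρ c t) :=
        mul_le_mul_of_nonneg_left hstep (mul_nonneg (by linarith) (by linarith))
      _ = (t + 1) * (n * (n - 1) * frontProb ρ c t) := by ring

end RandomSubset

/-! ## Strategies with a single HIRE signal -/

section Signals

theorem sum_prod_signal_eq_one {n : ℕ} {R : Type*} [CommRing R] (f : Fin n → (Fin n → Bool) → R)
    (hf : ∀ t σ σ', (∀ i < t, σ i = σ' i) → f t σ = f t σ') :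
    ∑ σ : Fin n → Bool, ∏ t, (if σ t then f t σ else 1 - f t σ) = 1 := by
  induction n with
  | zero => simp
  | succ n ih =>
    have hsum : ∀ G : (Fin (n + 1) → Bool) → R, ∑ σ, G σ =
        ∑ τ : Fin n → Bool, (G (Fin.snoc τ true) + G (Fin.snoc τ false)) := fun G => by
      rw [← (Fin.snocEquiv fun _ => Bool).sum_comp, Fintype.sum_prod_type_right]
      exact sum_congr rfl fun τ _ => Fintype.sum_bool _
    have hsnoc : ∀ t (τ : Fin n → Bool),
        f t (Fin.snoc (α := fun _ => Bool) τ false) = f t (Fin.snoc τ true) := by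
      refine fun t τ => hf _ _ _ fun i hi => ?_
      obtain ⟨k, rfl⟩ := Fin.exists_castSucc_eq.2 (Fin.ne_last_of_lt hi)
      rw [Fin.snoc_castSucc, Fin.snoc_castSucc]
    have hinit := ih (fun t τ => f t.castSucc (Fin.snoc τ true)) fun t τ τ' h => by
      refine hf _ _ _ fun i hi => ?_
      obtain ⟨k, rfl⟩ := Fin.exists_castSucc_eq.2 (Fin.ne_last_of_lt hi)
      rw [Fin.snoc_castSucc, Fin.snoc_castSucc, h k (Fin.castSucc_lt_castSucc_iff.1 hi)]
    rw [hsum]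
    refine Eq.trans (sum_congr rfl fun τ _ => ?_) hinit
    simp only [Fin.prod_univ_castSucc, Fin.snoc_castSucc, Fin.snoc_last, hsnoc, if_true,
      Bool.false_eq_true, if_false, ← mul_add, add_sub_cancel, mul_one]

variable {n : ℕ}

/-- The signals with a single HIRE, in round `j`. -/
def singleHire (j : Fin n) : Fin n → Bool := fun i => decide (i = j)

theorem singleHire_eq_true {i j : Fin n} : singleHire j i = true ↔ i = j :=
  decide_eq_true_iff

theorem singleHire_eq_false {i j : Fin n} : singleHire j i = false ↔ i ≠ j :=
  decide_eq_false_iff_not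

theorem singleHire_injective : Function.Injective (singleHire (n := n)) := fun _ _ h =>
  singleHire_eq_true.1 (h ▸ singleHire_eq_true.2 rfl)

theorem singleHire_agrees_iff_eq {t j : Fin n} {h : Fin n → Bool} (hlt : ∀ i < t, h i = false)
    (ht : h t = true) : (∀ i ≤ t, singleHire j i = h i) ↔ j = t := by
  refine ⟨fun hj => (singleHire_eq_true.1 ((hj t le_rfl).trans ht)).symm, ?_⟩
  rintro rfl i hi
  rcases hi.eq_or_lt with rfl | hi
  · rw [ht, singleHire_eq_true]
  · rw [hlt i hi, singleHire_eq_false]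
    exact hi.ne

theorem singleHire_agrees_iff_lt {t j : Fin n} {h : Fin n → Bool} (hle : ∀ i ≤ t, h i = false) :
    (∀ i ≤ t, singleHire j i = h i) ↔ t < j := by
  refine ⟨fun hj => lt_of_not_ge fun hjt => ?_, fun hj i hi => ?_⟩
  · exact singleHire_eq_false.1 ((hj j hjt).trans (hle j hjt)) rfl
  · rw [hle i hi, singleHire_eq_false]
    exact (hi.trans_lt hj).ne

end Signals

namespace Strategy

variable {n : ℕ} (φ : Strategy n) (I : Instance n)

theorem sum_signalProb (θ : Fin n → ℝ × ℝ) : ∑ σ, φ.signalProb θ σ = 1 :=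
  sum_prod_signal_eq_one (fun t => φ.hireProb t θ)
    fun t σ σ' h => φ.adapted t θ θ σ σ' (fun _ _ => rfl) h

theorem signalProb_nonneg (θ : Fin n → ℝ × ℝ) (σ : Fin n → Bool) : 0 ≤ φ.signalProb θ σ :=
  prod_nonneg fun t _ => by
    split_ifs
    exacts [φ.nonneg t θ σ, sub_nonneg.2 (φ.le_one t θ σ)]

theorem expect_eq (f : Perm (Fin n) → (Fin n → Bool) → ℝ) :
    φ.expect I f = 𝔼 π, ∑ σ, φ.signalProb (I.states π) σ * f π σ := by
  rw [expect, Fintype.expect_eq_sum_div_card, Fintype.card_perm, Fintype.card_fin]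

theorem expect_mono {f g : Perm (Fin n) → (Fin n → Bool) → ℝ} (h : ∀ π σ, f π σ ≤ g π σ) :
    φ.expect I f ≤ φ.expect I g := by
  rw [expect_eq, expect_eq]
  exact expect_le_expect fun π _ => sum_le_sum fun σ _ =>
    mul_le_mul_of_nonneg_left (h π σ) (φ.signalProb_nonneg _ σ)

theorem expect_add (f g : Perm (Fin n) → (Fin n → Bool) → ℝ) :
    φ.expect I (fun π σ => f π σ + g π σ) = φ.expect I f + φ.expect I g := by
  simp only [expect_eq, mul_add, sum_add_distrib, expect_add_distrib]

theorem expect_mul_const (f : Perm (Fin n) → (Fin n → Bool) → ℝ) (a : ℝ) :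
    φ.expect I (fun π σ => f π σ * a) = φ.expect I f * a := by
  simp only [expect_eq, ← mul_assoc, ← sum_mul, expect_mul]

theorem expect_order (f : Perm (Fin n) → ℝ) : φ.expect I (fun π _ => f π) = 𝔼 π, f π := by
  simp only [expect_eq, ← sum_mul, sum_signalProb, one_mul]

/-- `φ` sends exactly one HIRE signal, whatever pairs are revealed. -/
def SendsOneHire (φ : Strategy n) : Prop :=
  ∀ θ σ, φ.signalProb θ σ ≠ 0 → ∃ j, singleHire j = σ

/-- Probability of a single HIRE signal, in round `j`, for the arrival order `π`. -/
noncomputable def hireAtProb (π : Perm (Fin n)) (j : Fin n) : ℝ :=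
  φ.signalProb (I.states π) (singleHire j)

/-- Expected receiver value of the candidate of round `i`, counted only if the single HIRE signal
is sent in round `j`. -/
noncomputable def hireValue (j i : Fin n) : ℝ :=
  𝔼 π, φ.hireAtProb I π j * I.rv (π i)

/-- Probability of a single HIRE signal, in round `j`. -/
noncomputable def hireWeight (j : Fin n) : ℝ :=
  𝔼 π, φ.hireAtProb I π j

theorem hireValue_nonneg (j i : Fin n) : 0 ≤ φ.hireValue I j i :=
  expect_nonneg fun π _ => mul_nonneg (φ.signalProb_nonneg _ _) (I.rv_nonneg (π i))

variable {φ}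

theorem SendsOneHire.sum_signalProb_mul (hφ : φ.SendsOneHire) (θ : Fin n → ℝ × ℝ)
    (f : (Fin n → Bool) → ℝ) :
    ∑ σ, φ.signalProb θ σ * f σ = ∑ j, φ.signalProb θ (singleHire j) * f (singleHire j) := by
  refine (Fintype.sum_of_injective singleHire singleHire_injective _ _ (fun σ hσ => ?_)
    fun _ => rfl).symm
  by_contra hne
  exact hσ (hφ θ σ (left_ne_zero_of_mul hne))

theorem SendsOneHire.expect_eq (hφ : φ.SendsOneHire) (f : Perm (Fin n) → (Fin n → Bool) → ℝ) :
    φ.expect I f = ∑ j, 𝔼 π, φ.hireAtProb I π j * f π (singleHire j) := by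
  simp only [Strategy.expect_eq, hφ.sum_signalProb_mul]
  exact expect_sum_comm _ _ _

theorem SendsOneHire.expect_ite (hφ : φ.SendsOneHire) (P : (Fin n → Bool) → Prop)
    [DecidablePred P] (f : Perm (Fin n) → (Fin n → Bool) → ℝ) :
    φ.expect I (fun π σ => if P σ then f π σ else 0) =
      ∑ j with P (singleHire j), 𝔼 π, φ.hireAtProb I π j * f π (singleHire j) := by
  rw [hφ.expect_eq, sum_filter]
  refine sum_congr rfl fun j _ => ?_
  split_ifs <;> simp only [mul_zero, Fintype.expect_const]

theorem SendsOneHire.sum_hireWeight (hφ : φ.SendsOneHire) : ∑ j, φ.hireWeight I j = 1 := by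
  have h := hφ.expect_eq I fun _ _ => 1
  rw [expect_order, Fintype.expect_const] at h
  simp only [mul_one] at h
  exact h.symm

theorem SendsOneHire.sum_hireValue (hφ : φ.SendsOneHire) (i : Fin n) :
    ∑ j, φ.hireValue I j i = mean univ I.rv := by
  rw [← expect_apply_eq_mean I.rv i, ← expect_order φ I, hφ.expect_eq]
  rfl

end Strategy

namespace DecisionRule

variable {n : ℕ} {ψ : DecisionRule n} {t i : Fin n} {σ : Fin n → Bool}

theorem HiresAt.unique {i' : Fin n} (h : ψ.HiresAt t σ i) (h' : ψ.HiresAt t σ i') : i = i' := by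
  rcases lt_trichotomy i i' with hlt | heq | hlt
  · exact absurd h.2.1 (h'.2.2 i h.1 hlt)
  · exact heq
  · exact absurd h'.2.1 (h.2.2 i' h'.1 hlt)

theorem HiresAt.congr {σ' : Fin n → Bool} (h : ψ.HiresAt t σ i) (hσ : ∀ k ≤ i, σ k = σ' k) :
    ψ.HiresAt t σ' i :=
  ⟨h.1, (ψ.adapted i σ σ' hσ).1 h.2.1, fun j htj hji hj => h.2.2 j htj hji
    ((ψ.adapted j σ σ' fun k hk => hσ k (hk.trans hji.le)).2 hj)⟩

theorem HiresAt.payoff_eq (h : ψ.HiresAt t σ i) (I : Instance n) (π : Perm (Fin n)) :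
    ψ.payoff I t π σ = I.rv (π i) := by
  rw [payoff, sum_eq_single i (fun j _ hj => if_neg fun h' => hj (h'.unique h))
    fun hi => absurd (mem_univ i) hi, if_pos h]

theorem payoff_eq_zero (h : ∀ i, ¬ ψ.HiresAt t σ i) (I : Instance n) (π : Perm (Fin n)) :
    ψ.payoff I t π σ = 0 :=
  sum_eq_zero fun i _ => if_neg (h i)

theorem obedient_hiresAt {j : Fin n} (h : t ≤ j) : (obedient n).HiresAt t (singleHire j) j :=
  ⟨h, singleHire_eq_true.2 rfl, fun _ _ hi h' => hi.ne (singleHire_eq_true.1 h')⟩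

end DecisionRule

namespace Strategy

variable {n : ℕ} {φ : Strategy n} {I : Instance n}

/-- The candidate hired upon a HIRE signal in round `j` has on average at least the average
receiver value, and that signal carries no information on the candidates who arrive later. -/
structure HiresAboveAverage (φ : Strategy n) (I : Instance n) : Prop where
  later_eq : ∀ j i, j < i → φ.hireValue I j i = φ.hireWeight I j * mean univ I.rv
  mean_le : ∀ j, φ.hireWeight I j * mean univ I.rv ≤ φ.hireValue I j j

theorem expect_hireAtProb_mul_obedient_payoff {t j : Fin n} (h : t ≤ j) :
    𝔼 π, φ.hireAtProb I π j * (DecisionRule.obedient n).payoff I t π (singleHire j) =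
      φ.hireValue I j j := by
  simp only [(DecisionRule.obedient_hiresAt h).payoff_eq]
  rfl

theorem hireValue_le_hireValue_self (hI : φ.HiresAboveAverage I) {j i : Fin n} (h : j ≤ i) :
    φ.hireValue I j i ≤ φ.hireValue I j j := by
  rcases h.eq_or_lt with rfl | h
  · exact le_rfl
  · exact (hI.later_eq j i h).trans_le (hI.mean_le j)

/-- All rounds `j` together contribute the average receiver value to round `i`, and those with
`j ≤ i` at least their share of it. -/
theorem SendsOneHire.sum_hireValue_Ioi_le (hφ : φ.SendsOneHire) (hI : φ.HiresAboveAverage I)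
    (i : Fin n) :
    ∑ j ∈ Ioi i, φ.hireValue I j i ≤ ∑ j ∈ Ioi i, φ.hireValue I j j := by
  have hle : ∀ j ∉ Ioi i, 0 ≤ φ.hireValue I j i - φ.hireWeight I j * mean univ I.rv := by
    intro j hj
    rw [mem_Ioi, not_lt] at hj
    rcases hj.eq_or_lt with rfl | hj
    · exact sub_nonneg.2 (hI.mean_le j)
    · exact (sub_eq_zero.2 (hI.later_eq j i hj)).ge
  have hsum : ∑ j, (φ.hireValue I j i - φ.hireWeight I j * mean univ I.rv) = 0 := by
    rw [sum_sub_distrib, ← sum_mul, hφ.sum_hireValue, hφ.sum_hireWeight, one_mul, sub_self]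
  have hIoi := sum_le_sum_of_subset_of_nonneg (subset_univ (Ioi i)) fun j _ hj => hle j hj
  rw [hsum, sum_sub_distrib, sub_nonpos] at hIoi
  exact hIoi.trans (sum_le_sum fun j _ => hI.mean_le j)

theorem expect_hireAtProb_mul_payoff_le (hI : φ.HiresAboveAverage I) {ψ : DecisionRule n}
    {t j : Fin n} (h : ∀ i, ψ.HiresAt t (singleHire j) i → j ≤ i) :
    𝔼 π, φ.hireAtProb I π j * ψ.payoff I t π (singleHire j) ≤ φ.hireValue I j j := by
  by_cases hex : ∃ i, ψ.HiresAt t (singleHire j) i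
  · obtain ⟨i, hi⟩ := hex
    simp only [hi.payoff_eq]
    exact hireValue_le_hireValue_self hI (h i hi)
  · simp only [DecisionRule.payoff_eq_zero (not_exists.1 hex), mul_zero, Fintype.expect_const]
    exact φ.hireValue_nonneg I j j

/-- Until the HIRE signal arrives, a decision rule sees only NOT signals, so it has a fixed round
`i` in which it hires unless the HIRE signal arrives first. -/
theorem SendsOneHire.sum_expect_payoff_Ioi_le (hφ : φ.SendsOneHire)
    (hI : φ.HiresAboveAverage I) (ψ : DecisionRule n) (t : Fin n) :
    ∑ j ∈ Ioi t, 𝔼 π, φ.hireAtProb I π j * ψ.payoff I t π (singleHire j) ≤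
      ∑ j ∈ Ioi t, φ.hireValue I j j := by
  have hagree : ∀ {i j : Fin n}, i < j → ∀ k ≤ i, singleHire j k = false :=
    fun hij k hk => singleHire_eq_false.2 (hk.trans_lt hij).ne
  by_cases hex : ∃ i, ψ.HiresAt t (fun _ => false) i
  · obtain ⟨i, hi⟩ := hex
    have hIoi : {j ∈ Ioi t | i < j} = Ioi i := by
      ext j
      rw [mem_filter, mem_Ioi, mem_Ioi, and_iff_right_iff_imp]
      exact hi.1.trans_lt
    rw [← sum_filter_add_sum_filter_not (Ioi t) (i < ·),
      ← sum_filter_add_sum_filter_not (Ioi t) (i < ·) (fun j => φ.hireValue I j j), hIoi]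
    refine add_le_add ?_ (sum_le_sum fun j hj => ?_)
    · refine (sum_congr rfl fun j hj => ?_).trans_le (hφ.sum_hireValue_Ioi_le hI i)
      have hij := hi.congr fun k hk => (hagree (mem_Ioi.1 hj) k hk).symm
      simp only [hij.payoff_eq]
      rfl
    · refine expect_hireAtProb_mul_payoff_le hI fun i' hi' => ?_
      by_contra! hlt
      exact (mem_filter.1 hj).2 ((hi'.congr (hagree hlt)).unique hi ▸ hlt)
  · refine sum_le_sum fun j _ => expect_hireAtProb_mul_payoff_le hI fun i hi => ?_
    by_contra! hlt
    exact hex ⟨i, hi.congr (hagree hlt)⟩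

theorem SendsOneHire.persuasive (hφ : φ.SendsOneHire) (hI : φ.HiresAboveAverage I) :
    φ.Persuasive I := by
  intro t h hlt ψ
  rw [hφ.expect_ite, hφ.expect_ite]
  cases ht : h t with
  | true =>
    simp only [singleHire_agrees_iff_eq hlt ht, filter_eq', mem_univ, if_true, sum_singleton]
    rw [expect_hireAtProb_mul_obedient_payoff le_rfl]
    exact expect_hireAtProb_mul_payoff_le hI fun i hi => hi.1
  | false =>
    have hle : ∀ i ≤ t, h i = false := fun i hi =>
      hi.eq_or_lt.elim (fun hit => hit ▸ ht) (hlt i)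
    simp only [singleHire_agrees_iff_lt hle, filter_lt_eq_Ioi]
    refine (hφ.sum_expect_payoff_Ioi_le hI ψ t).trans_eq (sum_congr rfl fun j hj => ?_)
    rw [expect_hireAtProb_mul_obedient_payoff (mem_Ioi.1 hj).le]

end Strategy

/-! ## The Growing Pareto mechanism in random order -/

namespace Instance

variable {n : ℕ} (I : Instance n) (s : ℕ)

theorem expect_returnProb_mul (j : Fin n) {K : Perm (Fin n) → Fin n → ℝ}
    (hK : OrderInvariant (j + 1) K) :
    𝔼 π, I.returnProb (front π (j + 1)) (π j) * K π (π j) = 1 / (j + 1 : ℝ) *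
      𝔼 π, ∑ x ∈ front π (j + 1), I.returnProb (front π (j + 1)) x * K π x := by
  rw [expect_apply_eq_expect_front j
    (K := fun π x => I.returnProb (front π (j + 1)) x * K π x)
    (((orderInvariant_front le_rfl).prodMk hK).comp fun p x => I.returnProb p.1 x * p.2 x),
    mul_expect]
  refine expect_congr rfl fun π _ => ?_
  rw [expect_eq_sum_div_card, card_front_succ, Nat.cast_succ, one_div_mul_eq_div]

theorem mean_le_expect_returnProb_mul (j : Fin n) : 1 / (j + 1 : ℝ) * mean univ I.rv ≤
    𝔼 π : Perm (Fin n), I.returnProb (front π (j + 1)) (π j) * I.rv (π j) := by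
  rw [I.expect_returnProb_mul j (orderInvariant_const _ I.rv), ← expect_apply_eq_mean I.rv j,
    expect_apply_eq_expect_front j (orderInvariant_const _ I.rv)]
  refine mul_le_mul_of_nonneg_left (expect_le_expect fun π _ => ?_) (by positivity)
  rw [← mean_eq_expect]
  exact I.mean_le_sum_returnProb_mul ⟨π j, apply_mem_front_succ π j⟩

/-- Probability that the Growing Pareto mechanism signals HIRE in round `t` for the arrival order
`π`, provided that it has not done so before. -/
noncomputable def roundProb (π : Perm (Fin n)) (t : Fin n) : ℝ :=
  if (t : ℕ) + 1 = n then 1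
  else if (t : ℕ) + 1 ≤ s then 0
  else I.returnProb (front π (t + 1)) (π t)

theorem orderInvariant_roundProb (j : Fin n) : OrderInvariant j fun π => I.roundProb s π j := by
  unfold roundProb
  split_ifs
  · exact orderInvariant_const _ _
  · exact orderInvariant_const _ _
  · exact ((orderInvariant_front (Nat.le_succ _)).prodMk (orderInvariant_apply le_rfl)).comp
      fun p => I.returnProb p.1 p.2

end Instance

/-- Average of `roundProb` over the arrival orders. -/
noncomputable def meanRoundProb (n s t : ℕ) : ℝ :=
  if t + 1 = n then 1 else if t + 1 ≤ s then 0 else 1 / (t + 1)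

theorem meanRoundProb_le_one (n s t : ℕ) : meanRoundProb n s t ≤ 1 := by
  unfold meanRoundProb
  split_ifs
  exacts [le_rfl, zero_le_one, div_le_one_of_le₀ (by simp) (by positivity)]

/-- Probability that the Growing Pareto mechanism sends no HIRE signal in the first `t` rounds. -/
noncomputable def meanNoHireProb (n s t : ℕ) : ℝ :=
  ∏ u ∈ range t, (1 - meanRoundProb n s u)

theorem meanNoHireProb_nonneg (n s t : ℕ) : 0 ≤ meanNoHireProb n s t :=
  prod_nonneg fun u _ => sub_nonneg.2 (meanRoundProb_le_one n s u)

theorem meanNoHireProb_eq_div {n s t : ℕ} (hs : 1 ≤ s) (hst : s ≤ t) (ht : t < n) :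
    meanNoHireProb n s t = s / t := by
  induction t, hst using Nat.le_induction with
  | base =>
    rw [div_self (by positivity)]
    refine prod_eq_one fun u hu => ?_
    rw [mem_range] at hu
    rw [meanRoundProb, if_neg (by omega), if_pos (by omega), sub_zero]
  | succ t hst ih =>
    have hpos : 0 < t := by omega
    rw [meanNoHireProb, prod_range_succ, ← meanNoHireProb, ih (by omega), meanRoundProb,
      if_neg (by omega), if_neg (by omega)]
    push_cast
    field_simp
    ring

section RandomOrder

variable {n : ℕ} (I : Instance n) (s : ℕ)

theorem expect_roundProb_mul (j : Fin n) {g : Perm (Fin n) → ℝ} (hg : OrderInvariant (j + 1) g) :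
    𝔼 π, I.roundProb s π j * g π = meanRoundProb n s j * 𝔼 π, g π := by
  unfold Instance.roundProb meanRoundProb
  split_ifs
  · simp only [one_mul]
  · simp only [zero_mul, Fintype.expect_const]
  · rw [I.expect_returnProb_mul j (K := fun π _ => g π) (hg.comp fun y _ => y)]
    congr 1
    refine expect_congr rfl fun π _ => ?_
    rw [← sum_mul, I.sum_returnProb ⟨π j, apply_mem_front_succ π j⟩, one_mul]

theorem mean_le_expect_roundProb_mul (j : Fin n) :
    meanRoundProb n s j * mean univ I.rv ≤
      𝔼 π : Perm (Fin n), I.roundProb s π j * I.rv (π j) := by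
  unfold Instance.roundProb meanRoundProb
  split_ifs
  · simp only [one_mul, expect_apply_eq_mean, le_refl]
  · simp only [zero_mul, Fintype.expect_const, le_refl]
  · exact I.mean_le_expect_returnProb_mul j

end RandomOrder

section GrowingPareto

variable {n : ℕ} (I : Instance n) (s : ℕ)

theorem arrived_states (π : Perm (Fin n)) (t : Fin n) :
    arrived (I.states π) t = (front π (t + 1)).map ⟨I.pair, I.pair_injective⟩ := by
  classical
  rw [front_succ_eq_map, map_map, map_eq_image]
  unfold arrived
  congr

theorem growingPareto_hireProb_of_forall_lt {π : Perm (Fin n)} {t : Fin n} {σ : Fin n → Bool}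
    (hσ : ∀ i < t, σ i = false) :
    (growingPareto n s).hireProb t (I.states π) σ = I.roundProb s π t := by
  have hnone : ¬ ∃ i < t, σ i = true := fun ⟨i, hi, h⟩ => by simp [hσ i hi] at h
  simp only [growingPareto, if_neg hnone, arrived_states]
  rfl

theorem growingPareto_hireProb_eq_zero {θ : Fin n → ℝ × ℝ} {i t : Fin n} {σ : Fin n → Bool}
    (hit : i < t) (hi : σ i = true) : (growingPareto n s).hireProb t θ σ = 0 :=
  if_pos ⟨i, hit, hi⟩

theorem growingPareto_hireProb_last {θ : Fin n → ℝ × ℝ} {t : Fin n} {σ : Fin n → Bool}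
    (ht : (t : ℕ) + 1 = n) (hσ : ∀ i < t, σ i = false) :
    (growingPareto n s).hireProb t θ σ = 1 := by
  have hnone : ¬ ∃ i < t, σ i = true := fun ⟨i, hi, h⟩ => by simp [hσ i hi] at h
  exact (if_neg hnone).trans (if_pos ht)

theorem growingPareto_sendsOneHire (hn : 0 < n) : (growingPareto n s).SendsOneHire := by
  intro θ σ hσ
  have hfactor := prod_ne_zero_iff.1 hσ
  by_cases hex : ∃ j, σ j = true
  · obtain ⟨j, hj⟩ := hex
    have hnotlt : ∀ {i k : Fin n}, σ i = true → σ k = true → ¬ i < k := fun {i k} hi hk hik => by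
      have hk' := hfactor k (mem_univ k)
      rw [if_pos hk] at hk'
      exact hk' (growingPareto_hireProb_eq_zero s hik hi)
    refine ⟨j, funext fun i => Bool.eq_iff_iff.2 ?_⟩
    rw [singleHire_eq_true]
    exact ⟨fun h => h ▸ hj, fun hi =>
      le_antisymm (not_lt.1 (hnotlt hj hi)) (not_lt.1 (hnotlt hi hj))⟩
  · have hfalse : ∀ i, σ i = false := fun i => Bool.eq_false_of_not_eq_true fun h => hex ⟨i, h⟩
    have hlast := hfactor ⟨n - 1, by omega⟩ (mem_univ _)
    rw [hfalse, growingPareto_hireProb_last s (Nat.sub_add_cancel hn) fun i _ => hfalse i] at hlast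
    simp at hlast

theorem growingPareto_hireAtProb (π : Perm (Fin n)) (j : Fin n) :
    (growingPareto n s).hireAtProb I π j =
      (∏ u : Fin n with u.val < j.val, (1 - I.roundProb s π u)) * I.roundProb s π j := by
  have hfactor : ∀ t ∈ univ, (if singleHire j t then
      (growingPareto n s).hireProb t (I.states π) (singleHire j) else
      1 - (growingPareto n s).hireProb t (I.states π) (singleHire j)) =
      (if t.val < j then 1 - I.roundProb s π t else 1) *
        if t = j then I.roundProb s π t else 1 := by
    intro t _
    rcases lt_trichotomy t j with htj | rfl | hjt
    · rw [growingPareto_hireProb_of_forall_lt I s fun i hi =>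
          singleHire_eq_false.2 (hi.trans htj).ne,
        if_neg (ne_true_of_eq_false (singleHire_eq_false.2 htj.ne)), if_pos (Fin.lt_def.1 htj),
        if_neg htj.ne, mul_one]
    · rw [growingPareto_hireProb_of_forall_lt I s fun i hi => singleHire_eq_false.2 hi.ne,
        if_pos (singleHire_eq_true.2 rfl), if_neg (lt_irrefl _), if_pos rfl, one_mul]
    · rw [growingPareto_hireProb_eq_zero s hjt (singleHire_eq_true.2 rfl),
        if_neg (ne_true_of_eq_false (singleHire_eq_false.2 hjt.ne')),
        if_neg (Fin.lt_def.1 hjt).not_gt, if_neg hjt.ne', sub_zero, one_mul]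
  rw [Strategy.hireAtProb, Strategy.signalProb, prod_congr rfl hfactor, prod_mul_distrib,
    prod_ite_eq', if_pos (mem_univ j), ← prod_filter]

theorem expect_growingPareto_hireAtProb_mul (j : Fin n) {g : Perm (Fin n) → ℝ}
    (hg : OrderInvariant j g) :
    𝔼 π, (growingPareto n s).hireAtProb I π j * g π =
      meanNoHireProb n s j * 𝔼 π, I.roundProb s π j * g π := by
  simp only [growingPareto_hireAtProb, mul_assoc]
  refine expect_prod_mul_of_orderInvariant (F := fun u π => 1 - I.roundProb s π u)
    (q := fun u => 1 - meanRoundProb n s u)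
    (fun u => (I.orderInvariant_roundProb s u).comp fun x => 1 - x) (fun u g hg => ?_) j.2.le
    ((I.orderInvariant_roundProb s j).mul hg)
  simp only [sub_mul, one_mul, expect_sub_distrib, expect_roundProb_mul I s u hg]

theorem growingPareto_hireWeight (j : Fin n) :
    (growingPareto n s).hireWeight I j = meanNoHireProb n s j * meanRoundProb n s j := by
  have h := expect_growingPareto_hireAtProb_mul I s j (orderInvariant_const _ 1)
  rw [expect_roundProb_mul I s j (orderInvariant_const _ 1), Fintype.expect_const] at h
  simp only [mul_one] at h
  exact h

theorem growingPareto_hiresAboveAverage : (growingPareto n s).HiresAboveAverage I where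
  later_eq j i hji := by
    have hrv : OrderInvariant (j + 1) fun π : Perm (Fin n) => I.rv (π i) :=
      (orderInvariant_apply (Nat.succ_le_of_lt hji)).comp I.rv
    rw [Strategy.hireValue, expect_growingPareto_hireAtProb_mul I s j (hrv.mono (Nat.le_succ _)),
      expect_roundProb_mul I s j hrv, expect_apply_eq_mean, growingPareto_hireWeight, mul_assoc]
  mean_le j := by
    rw [Strategy.hireValue, expect_growingPareto_hireAtProb_mul I s j
      ((orderInvariant_apply le_rfl).comp I.rv), growingPareto_hireWeight, mul_assoc]
    exact mul_le_mul_of_nonneg_left (mean_le_expect_roundProb_mul I s j)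
      (meanNoHireProb_nonneg n s j)

theorem growingPareto_persuasive : (growingPareto n s).Persuasive I := fun t =>
  (growingPareto_sendsOneHire s (Fin.pos t)).persuasive (growingPareto_hiresAboveAverage I s) t

end GrowingPareto

/-! ## Success probability and benchmark -/

section SuccessLowerBound

variable {n : ℕ} (I : Instance n) {c : Fin n}

theorem Strategy.SendsOneHire.success_eq {φ : Strategy n} (hφ : φ.SendsOneHire)
    (hcmax : ∀ j, I.sv j ≤ I.sv c) :
    φ.success I = ∑ j, 𝔼 π, φ.hireAtProb I π j * if π j = c then 1 else 0 := by
  rw [Strategy.success, hφ.expect_eq]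
  congr! 6 with j _ π _
  constructor
  · rintro ⟨t, ⟨ht, -⟩, hmax⟩
    rw [← singleHire_eq_true.1 ht]
    exact I.sv_injective ((hcmax _).antisymm (hmax c))
  · rintro rfl
    exact ⟨j, ⟨singleHire_eq_true.2 rfl, fun i hi => singleHire_eq_false.2 hi.ne⟩, hcmax⟩

theorem frontProb_le_mul_expect_returnProb (hcmax : ∀ j, I.sv j ≤ I.sv c) (j : Fin n) :
    frontProb I.rv c (j + 1) ≤ (j + 1 : ℝ) *
      𝔼 π, I.returnProb (front π (j + 1)) (π j) * if π j = c then 1 else 0 := by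
  rw [I.expect_returnProb_mul j (K := fun _ x => if x = c then 1 else 0)
    (orderInvariant_const _ _), ← mul_assoc, mul_one_div_cancel (by positivity), one_mul]
  refine expect_le_expect fun π _ => ?_
  simp only [mul_boole, sum_ite_eq']
  split_ifs with hc
  · exact I.favoriteProb_le_returnProb hc fun k _ => hcmax k
  · exact le_rfl

theorem le_expect_growingPareto_hireAtProb_mul {s : ℕ} (hs : 1 ≤ s)
    (hcmax : ∀ j, I.sv j ≤ I.sv c) {j : Fin n} (hsj : s ≤ j) (hj : (j : ℕ) + 1 < n) :
    s / (n * (n - 1)) * favoriteProb univ I.rv c ≤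
      𝔼 π, (growingPareto n s).hireAtProb I π j * if π j = c then 1 else 0 := by
  have hround : ∀ π, I.roundProb s π j = I.returnProb (front π (j + 1)) (π j) := fun π => by
    rw [Instance.roundProb, if_neg hj.ne, if_neg (by omega)]
  rw [expect_growingPareto_hireAtProb_mul I s j ((orderInvariant_apply le_rfl).comp fun x =>
    if x = c then 1 else 0), meanNoHireProb_eq_div hs hsj j.2]
  simp only [hround]
  have hfront := frontProb_le_mul_expect_returnProb I hcmax j
  have hfav := mul_favoriteProb_univ_le (ρ := I.rv) (c := c) hj.le
  set X := 𝔼 π, I.returnProb (front π (j + 1)) (π j) * if π j = c then (1 : ℝ) else 0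
  have hj0 : (0 : ℝ) < j := by exact_mod_cast hs.trans hsj
  have hjn : (j : ℝ) + 1 < n := by exact_mod_cast hj
  have hn0 : (0 : ℝ) < n := by linarith
  have hn1 : (0 : ℝ) < n - 1 := by linarith
  have hX : j * favoriteProb univ I.rv c ≤ n * (n - 1) * X := by
    refine le_of_mul_le_mul_left ?_ (add_pos hj0 one_pos)
    calc (j + 1) * (j * favoriteProb univ I.rv c)
        = ((j : ℕ) + 1 : ℕ) * (((j : ℕ) + 1 : ℕ) - 1 : ℝ) * favoriteProb univ I.rv c := by
          push_cast; ring
      _ ≤ n * (n - 1) * ((j + 1) * X) := hfav.trans (by gcongr)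
      _ = (j + 1) * (n * (n - 1) * X) := by ring
  calc s / (n * (n - 1)) * favoriteProb univ I.rv c
      = s / (n * (n - 1) * j) * (j * favoriteProb univ I.rv c) := by field_simp
    _ ≤ s / (n * (n - 1) * j) * (n * (n - 1) * X) := by gcongr
    _ = s / j * X := by field_simp

theorem mul_favoriteProb_le_growingPareto_success {s : ℕ} (hs : 1 ≤ s) (hsn : s + 1 ≤ n)
    (hcmax : ∀ j, I.sv j ≤ I.sv c) :
    s * (n - 1 - s) / (n * (n - 1)) * favoriteProb univ I.rv c ≤ (growingPareto n s).success I := by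
  rw [(growingPareto_sendsOneHire s (Fin.pos c)).success_eq I hcmax]
  let J : Finset (Fin n) := (Ico s (n - 1)).attachFin fun m hm => by
    rw [mem_Ico] at hm
    omega
  have hJ : (#J : ℝ) = n - 1 - s := by
    rw [card_attachFin, Nat.card_Ico, Nat.cast_sub (by omega), Nat.cast_sub (by omega),
      Nat.cast_one]
  calc s * (n - 1 - s) / (n * (n - 1)) * favoriteProb univ I.rv c
      = ∑ _j ∈ J, s / (n * (n - 1)) * favoriteProb univ I.rv c := by
        rw [sum_const, nsmul_eq_mul, hJ]
        ring
    _ ≤ ∑ j ∈ J, 𝔼 π, (growingPareto n s).hireAtProb I π j * if π j = c then 1 else 0 := by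
        refine sum_le_sum fun j hj => ?_
        rw [mem_attachFin, mem_Ico] at hj
        exact le_expect_growingPareto_hireAtProb_mul I hs hcmax hj.1 (by omega)
    _ ≤ ∑ j, 𝔼 π, (growingPareto n s).hireAtProb I π j * if π j = c then 1 else 0 := by
        refine sum_le_sum_of_subset_of_nonneg (subset_univ J) fun j _ _ =>
          expect_nonneg fun π _ => mul_nonneg (Strategy.signalProb_nonneg _ _ _) ?_
        split_ifs
        exacts [zero_le_one, le_rfl]

end SuccessLowerBound

section Benchmark

variable {n : ℕ} {I : Instance n} {φ : Strategy n}

theorem Strategy.success_nonneg (φ : Strategy n) (I : Instance n) : 0 ≤ φ.success I := by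
  refine le_of_eq_of_le ?_ (φ.expect_mono I (f := fun _ _ => 0) fun π σ => ?_)
  · rw [expect_order, Fintype.expect_const]
  · split_ifs
    exacts [zero_le_one, le_rfl]

theorem Strategy.success_le_one (φ : Strategy n) (I : Instance n) : φ.success I ≤ 1 := by
  refine (φ.expect_mono I (g := fun _ _ => 1) fun π σ => ?_).trans_eq ?_
  · split_ifs
    exacts [le_rfl, zero_le_one]
  · rw [expect_order, Fintype.expect_const]

theorem Strategy.Persuasive.expect_payoff_le (hφ : φ.Persuasive I) {t : Fin n} (ht : IsBot t)
    (ψ : DecisionRule n) :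
    φ.expect I (ψ.payoff I t) ≤ φ.expect I ((DecisionRule.obedient n).payoff I t) := by
  classical
  have hsplit : ∀ ψ' : DecisionRule n, φ.expect I (ψ'.payoff I t) =
      φ.expect I (fun π σ => if ∀ i ≤ t, σ i = true then ψ'.payoff I t π σ else 0) +
        φ.expect I (fun π σ => if ∀ i ≤ t, σ i = false then ψ'.payoff I t π σ else 0) := by
    intro ψ'
    rw [← expect_add]
    congr! 3 with π σ
    have hfirst : ∀ b : Bool, (∀ i ≤ t, σ i = b) ↔ σ t = b := fun b =>
      ⟨fun h => h t le_rfl, fun h i hi => le_antisymm hi (ht i) ▸ h⟩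
    simp only [hfirst]
    cases σ t <;> simp
  have hnone : ∀ (b : Bool) (i : Fin n), i < t → b = false := fun b i hi =>
    absurd (ht i) hi.not_ge
  rw [hsplit, hsplit]
  exact add_le_add (hφ t (fun _ => true) (hnone true) ψ) (hφ t (fun _ => false) (hnone false) ψ)

/-- A receiver who hires the first candidate gets the average value. -/
theorem Strategy.Persuasive.mean_le (hφ : φ.Persuasive I) {t : Fin n} (ht : IsBot t) :
    mean univ I.rv ≤ φ.expect I ((DecisionRule.obedient n).payoff I t) := by
  let hireFirst : DecisionRule n := ⟨fun _ _ => True, fun _ _ _ _ => Iff.rfl⟩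
  have hpayoff : hireFirst.payoff I t = fun π _ => I.rv (π t) := funext₂ fun π σ =>
    DecisionRule.HiresAt.payoff_eq ⟨le_rfl, trivial, fun j h1 h2 _ => h2.not_ge h1⟩ I π
  have h := hφ.expect_payoff_le ht hireFirst
  rwa [hpayoff, expect_order, expect_apply_eq_mean] at h

open Classical in
theorem obedient_payoff_le {t c b : Fin n} (ht : IsBot t) (hcmax : ∀ j, I.sv j ≤ I.sv c)
    (hbmax : ∀ j, I.rv j ≤ I.rv b) (π : Perm (Fin n)) (σ : Fin n → Bool) :
    (DecisionRule.obedient n).payoff I t π σ ≤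
      (if ∃ i, (σ i = true ∧ ∀ j < i, σ j = false) ∧ ∀ k, I.sv k ≤ I.sv (π i) then 1 else 0) *
        (I.rv c - I.rv b) + I.rv b := by
  split_ifs with hsuccess
  · obtain ⟨i, ⟨hi, hfirst⟩, hmax⟩ := hsuccess
    have hhires : (DecisionRule.obedient n).HiresAt t σ i :=
      ⟨ht i, hi, fun j _ hj => ne_true_of_eq_false (hfirst j hj)⟩
    have hc : π i = c := I.sv_injective ((hcmax _).antisymm (hmax c))
    rw [hhires.payoff_eq, hc, one_mul, sub_add_cancel]
  · rw [zero_mul, zero_add]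
    by_cases hex : ∃ i, (DecisionRule.obedient n).HiresAt t σ i
    · obtain ⟨i, hi⟩ := hex
      exact (hi.payoff_eq I π).trans_le (hbmax _)
    · exact (DecisionRule.payoff_eq_zero (not_exists.1 hex) I π).trans_le (I.rv_nonneg b)

theorem Strategy.Persuasive.success_le (hφ : φ.Persuasive I) {c : Fin n}
    (hcmax : ∀ j, I.sv j ≤ I.sv c) : φ.success I ≤ favoriteProb univ I.rv c := by
  obtain ⟨b, hb, hbmax⟩ := univ.exists_max_image I.rv ⟨c, mem_univ c⟩
  have hbot : IsBot (⟨0, Fin.pos c⟩ : Fin n) := fun i => Fin.le_def.2 (Nat.zero_le i)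
  refine (le_favoriteProb_iff hb hbmax (mem_univ c)).2 ⟨φ.success_le_one I, ?_⟩
  calc mean univ I.rv ≤ φ.expect I ((DecisionRule.obedient n).payoff I ⟨0, Fin.pos c⟩) :=
        hφ.mean_le hbot
    _ ≤ _ := φ.expect_mono I (obedient_payoff_le hbot hcmax fun j => hbmax j (mem_univ j))
    _ = φ.success I * (I.rv c - I.rv b) + I.rv b := by
        rw [expect_add, expect_mul_const, expect_order, Fintype.expect_const]
        rfl
    _ = φ.success I * I.rv c + (1 - φ.success I) * I.rv b := by ring

theorem benchmarkSuccess_le {c : Fin n} (hcmax : ∀ j, I.sv j ≤ I.sv c) :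
    benchmarkSuccess I ≤ favoriteProb univ I.rv c := by
  refine Real.sSup_le ?_ (favoriteProb_nonneg (mem_univ c))
  rintro _ ⟨φ, hφ, rfl⟩
  exact hφ.success_le hcmax

theorem benchmarkSuccess_nonneg (I : Instance n) : 0 ≤ benchmarkSuccess I := by
  refine Real.sSup_nonneg ?_
  rintro _ ⟨φ, -, rfl⟩
  exact φ.success_nonneg I

theorem mul_benchmarkSuccess_le_growingPareto_success (I : Instance n) (s : ℕ) :
    s * (n - 1 - s) / (n * (n - 1)) * benchmarkSuccess I ≤ (growingPareto n s).success I := by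
  have hden : (0 : ℝ) ≤ n * (n - 1) := by
    rcases n.eq_zero_or_pos with rfl | hn
    · simp
    · exact mul_nonneg (Nat.cast_nonneg n) (sub_nonneg.2 (Nat.one_le_cast.2 hn))
  by_cases hs : 1 ≤ s ∧ s + 1 ≤ n
  · obtain ⟨c, -, hcmax⟩ := univ.exists_max_image I.sv ⟨⟨s, hs.2⟩, mem_univ _⟩
    replace hcmax : ∀ j, I.sv j ≤ I.sv c := fun j => hcmax j (mem_univ j)
    have hsn : (s : ℝ) + 1 ≤ n := by exact_mod_cast hs.2
    refine (mul_le_mul_of_nonneg_left (benchmarkSuccess_le hcmax) ?_).trans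
      (mul_favoriteProb_le_growingPareto_success I hs.1 hs.2 hcmax)
    exact div_nonneg (mul_nonneg (Nat.cast_nonneg s) (by linarith)) hden
  · have hnum : (s : ℝ) * (n - 1 - s) ≤ 0 := by
      rcases s.eq_zero_or_pos with rfl | hpos
      · simp
      · have hns : (n : ℝ) ≤ s := by
          rw [Nat.cast_le]
          omega
        exact mul_nonpos_of_nonneg_of_nonpos (Nat.cast_nonneg s) (by linarith)
    exact (mul_nonpos_of_nonpos_of_nonneg (div_nonpos_of_nonpos_of_nonneg hnum hden)
      (benchmarkSuccess_nonneg I)).trans ((growingPareto n s).success_nonneg I)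

end Benchmark

section Limit

open Filter Topology

theorem tendsto_mul_sub_div_mul_sub_one {s : ℕ → ℕ} {r : ℝ}
    (hs : Tendsto (fun n : ℕ => (s n : ℝ) / n) atTop (𝓝 r)) :
    Tendsto (fun n : ℕ => (s n : ℝ) * (n - 1 - s n) / (n * (n - 1))) atTop
      (𝓝 (r * (1 - r))) := by
  have hinv : Tendsto (fun n : ℕ => 1 - 1 / (n : ℝ)) atTop (𝓝 1) := by
    simpa using (tendsto_one_div_atTop_nhds_zero_nat (𝕜 := ℝ)).const_sub 1
  have hlim := (hs.mul (hinv.sub hs)).div hinv one_ne_zero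
  rw [div_one] at hlim
  refine hlim.congr' ?_
  filter_upwards [eventually_gt_atTop 1] with n hn
  have hn1 : (1 : ℝ) < n := by exact_mod_cast hn
  have hn2 : (n : ℝ) - 1 ≠ 0 := by linarith
  have hn0 : (n : ℝ) ≠ 0 := by linarith
  rw [Pi.div_apply, one_sub_div hn0]
  field_simp

theorem tendsto_nat_half_div : Tendsto (fun n : ℕ => ((n / 2 : ℕ) : ℝ) / n) atTop (𝓝 (1 / 2)) := by
  refine ((tendsto_nat_floor_mul_div_atTop (R := ℝ) one_half_pos.le).comp
    tendsto_natCast_atTop_atTop).congr fun n => ?_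
  rw [Function.comp_apply, one_div_mul_eq_div, Nat.floor_div_ofNat, Nat.floor_natCast]

end Limit

end OnlinePersuasion

theorem mainTheorem3_general (s : ℕ → ℕ) (r : ℝ)
    (hs : Filter.Tendsto (fun n : ℕ => (s n : ℝ) / n) Filter.atTop (nhds r)) :
    (∀ (n : ℕ) (I : OnlinePersuasion.Instance n),
      (OnlinePersuasion.growingPareto n (s n)).Persuasive I) ∧
    ∃ ε : ℕ → ℝ, Filter.Tendsto ε Filter.atTop (nhds 0) ∧
      ∀ (n : ℕ) (I : OnlinePersuasion.Instance n),
        (r * (1 - r) - ε n) * OnlinePersuasion.benchmarkSuccess I ≤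
          (OnlinePersuasion.growingPareto n (s n)).success I := by
  refine ⟨fun n I => OnlinePersuasion.growingPareto_persuasive I (s n),
    fun n => r * (1 - r) - s n * (n - 1 - s n) / (n * (n - 1)), ?_, fun n I => ?_⟩
  · simpa using (OnlinePersuasion.tendsto_mul_sub_div_mul_sub_one hs).const_sub (r * (1 - r))
  · rw [sub_sub_cancel]
    exact OnlinePersuasion.mul_benchmarkSuccess_le_growingPareto_success I (s n)

theorem mainTheorem3 :
    (∀ (n : ℕ) (I : OnlinePersuasion.Instance n),
      (OnlinePersuasion.growingPareto n (n / 2)).Persuasive I) ∧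
    ∃ ε : ℕ → ℝ, Filter.Tendsto ε Filter.atTop (nhds 0) ∧
      ∀ (n : ℕ) (I : OnlinePersuasion.Instance n),
        (1 / 4 - ε n) * OnlinePersuasion.benchmarkSuccess I ≤
          (OnlinePersuasion.growingPareto n (n / 2)).success I := by
  rw [show (1 / 4 : ℝ) = 1 / 2 * (1 - 1 / 2) by norm_num]
  exact mainTheorem3_general (fun n => n / 2) (1 / 2) OnlinePersuasion.tendsto_nat_half_div
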